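/- **Setting.** Let $n\ge 2$, $m\ge 1$ be integers and $p$ a prime. Let $\mathbb H_n$ be the set of complex symmetric $n\times n$ matrices with positive definite imaginary part, $\mathbb H_{n,m}=\mathbb H_n\times\mathbb C^{(m,n)}$, $J_n=\begin{pmatrix}0&I_n\\-I_n&0\end{pmatrix}$, $\Gamma_n=Sp(n,\mathbb Z)$, $O_n(\ell)=\{M\in\mathbb Z^{(2n,2n)}\mid {}^tMJ_nM=\ell J_n\}$ and $O_{n,p}=\bigcup_{l\ge0}O_n(p^l)$. Let $\sigma$ denote the trace. Let $\mathcal M$ be a real symmetric, half-integral, positive semi-definite $m\times m$ matrix. *Slash action.* Let $\rho:GL(n,\mathbb C)\to GL(V_\rho)$ be a rational representation on a finite dimensional complex vector space. For $g=\begin{pmatrix}A&B\\C&D\end{pmatrix}\in O_n(\ell)$, integral $\lambda,\mu\in\mathbb Z^{(m,n)}$, $\kappa\in\mathbb Z^{(m,m)}$ and $f:\mathbb H_{n,m}\to V_\rho$ put, with $W=Z+\lambda\Omega+\mu$, $$\big(f|_{\rho,\mathcal M}[(g,(\lambda,\mu;\kappa))]\big)(\Omega,Z)=e^{-2\pi i\ell\,\sigma(\mathcal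 M W(C\Omega+D)^{-1}C\,{}^tW)}\,e^{2\pi i\ell\,\sigma(\mathcal M(\lambda\Omega\,{}^t\lambda+2\lambda\,{}^tZ+\kappa+\mu\,{}^t\lambda))}\,\rho(C\Omega+D)^{-1}f\big((A\Omega+B)(C\Omega+D)^{-1},\ \ell\,W(C\Omega+D)^{-1}\big).$$ For $\ell=1$ this is the usual action of the Jacobi group. *Jacobi forms.* $J_{\rho,\mathcal M}(\Gamma_n)$ is the space of holomorphic $f:\mathbb H_{n,m}\to V_\rho$ such that (A) $f|_{\rho,\mathcal M}[(\gamma,(\lambda,\mu;\kappa))]=f$ for all $\gamma\in\Gamma_n$ and all integral $\lambda,\mu,\kappa$ with $\kappa+\mu\,{}^t\lambda$ symmetric, and (B) for some nonzero integer $\lambda_\Gamma$ and every $\gamma\in\Gamma_n$, $f|_{\rho,\mathcal M}[(\gamma,(0,0;0))]$ has a Fourier expansion $\sum_{T,R}c(T,R)\,e^{\frac{2\pi i}{\lambda_\Gamma}\sigma(T\Omega)}e^{2\pi i\sigma(RZ)}$ over half-integral $T={}^tT\ge0$ and $R\in\mathbb Z^{(n,m)}$, with $c(T,R)\neq0$ only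 if $\begin{pmatrix}\frac1{\lambda_\Gamma}T&\frac12R\\\frac12{}^tR&\mathcal M\end{pmatrix}\ge0$. *Hecke operators.* Let $\check{\mathscr L}_{n,p}$ and $\check{\mathscr H}_{n,p}$ be the $\mathbb C$-modules freely generated by the left cosets $\Gamma_nM$ and by the double cosets $\Gamma_nM\Gamma_n$, $M\in O_{n,p}$, and let $j:\check{\mathscr H}_{n,p}\to\check{\mathscr L}_{n,p}$ be the injective linear map sending a double coset to the (finite) sum of the left cosets of which it is the disjoint union. Put $f|\Gamma_nM=f|_{\rho,\mathcal M}[(M,(0,0;0))]$, extend linearly to $\check{\mathscr L}_{n,p}$, and put $f|T=f|j(T)$ for $T\in\check{\mathscr H}_{n,p}$. *Zharkovskaya map.* Fix $r\in\mathbb Z$. Every left coset in $O_{n,p}$ has a representative $M=\begin{pmatrix}A&B\\0&D\end{pmatrix}$ with $$A=\begin{pmatrix}a&{}^t\alpha\\0&A^*\end{pmatrix},\quad B=\begin{pmatrix}b&{}^t\beta_1\\\beta_2&B^*\end{pmatrix},\quad D=\begin{pmatrix}d&0\\\delta&D^*\end{pmatrix},\quad d>0.$$ Put $M^*=\begin{pmatrix}A^*&B^*\\0&D^*\end{pmatrix}\in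 O_{n-1,p}$ and $(\Gamma_nM)^*=d^{-r}\,\Gamma_{n-1}M^*$, and extend linearly to $\check{\mathscr L}_{n,p}\to\check{\mathscr L}_{n-1,p}$. For $T\in\check{\mathscr H}_{n,p}$, the element $T^*\in\check{\mathscr H}_{n-1,p}$ (with parameter $r$) is the one with $j(T^*)=j(T)^*$. *Modified Siegel–Jacobi operator.* For $(\Omega,Z)\in\mathbb H_{n-1,m}$, $$(\Psi^0_{n,n-1}f)(\Omega,Z)=\lim_{t\to\infty}f\left(\begin{pmatrix}it&0\\0&\Omega\end{pmatrix},(0,Z)\right).$$ **Theorem 9.4.** Let $\rho:GL(n,\mathbb C)\to GL(V_\rho)$ and $\rho_0:GL(n-1,\mathbb C)\to GL(V_{\rho_0})$ be rational finite dimensional representations, $R:V_\rho\to V_{\rho_0}$ a linear map and $k\in\mathbb Z$ such that 1. $R\circ\rho\begin{pmatrix}1&0\\0&A\end{pmatrix}=\rho_0(A)\circ R$ for all $A\in GL(n-1,\mathbb C)$; 2. $R\circ\rho\begin{pmatrix}a&0\\0&I_{n-1}\end{pmatrix}=a^kR$ for all $a\in\mathbb C^\times$. Then for all $f\in J_{\rho,\mathcal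 M}(\Gamma_n)$ and $T\in\check{\mathscr H}_{n,p}$, the element $T^*\in\check{\mathscr H}_{n-1,p}$ with parameter $r=k$ exists, the limits defining $\Psi^0_{n,n-1}f$ and $\Psi^0_{n,n-1}(f|T)$ exist on $\mathbb H_{n-1,m}$, and $$(R\circ\Psi^0_{n,n-1})(f|T)=\big(R\circ\Psi^0_{n,n-1}f\big)\big|T^*\qquad\text{on }\mathbb H_{n-1,m},$$ where on the right $T^*$ acts through $\rho_0$ and $\mathcal M$. -/

import Mathlib

open scoped Matrix Topology

noncomputable section

namespace SiegelJacobi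

open Matrix Filter

/-! ### The Siegel upper half plane, rational representations -/

/-- The Siegel upper half plane `ℍₙ`: complex symmetric matrices with positive definite
imaginary part. -/
def siegelH (n : ℕ) : Set (Matrix (Fin n) (Fin n) ℂ) :=
  {Ω | Ω.IsSymm ∧ (Ω.map Complex.im).PosDef}

/-- A representation of `GL(n, ℂ)` is rational if its matrix coefficients are regular functions on
`GL(n, ℂ)`, i.e. polynomials in the matrix entries divided by a power of the determinant. -/
def IsRationalRep {n : ℕ} {V : Type*} [AddCommGroup V] [Module ℂ V]
    (ρ : Representation ℂ (GeneralLinearGroup (Fin n) ℂ) V) : Prop :=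
  ∀ (v : V) (φ : Module.Dual ℂ V), ∃ (P : MvPolynomial (Fin n × Fin n) ℂ) (s : ℕ),
    ∀ g : GeneralLinearGroup (Fin n) ℂ,
      φ (ρ g v) * (g : Matrix (Fin n) (Fin n) ℂ).det ^ s
        = MvPolynomial.eval (fun ij => (g : Matrix (Fin n) (Fin n) ℂ) ij.1 ij.2) P

open Classical in
/-- `ρ(X)⁻¹ v` for an invertible matrix `X`. (It is only used for `X = CΩ + D`, which is
invertible for `Ω ∈ ℍₙ`; the value for singular `X` plays no role.) -/
def repInv {n : ℕ} {V : Type*} [AddCommGroup V] [Module ℂ V]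
    (ρ : Representation ℂ (GeneralLinearGroup (Fin n) ℂ) V)
    (X : Matrix (Fin n) (Fin n) ℂ) (v : V) : V :=
  if h : IsUnit X then ρ (h.unit⁻¹) v else 0

/-! ### The slash action -/

/-- The complex blocks `A, B, C, D` of an integral `2n × 2n` matrix. -/
def blkA {n : ℕ} (g : Matrix (Fin n ⊕ Fin n) (Fin n ⊕ Fin n) ℤ) : Matrix (Fin n) (Fin n) ℂ :=
  g.toBlocks₁₁.map (fun a => (a : ℂ))

/-- See `blkA`. -/
def blkB {n : ℕ} (g : Matrix (Fin n ⊕ Fin n) (Fin n ⊕ Fin n) ℤ) : Matrix (Fin n) (Fin n) ℂ :=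
  g.toBlocks₁₂.map (fun a => (a : ℂ))

/-- See `blkA`. -/
def blkC {n : ℕ} (g : Matrix (Fin n ⊕ Fin n) (Fin n ⊕ Fin n) ℤ) : Matrix (Fin n) (Fin n) ℂ :=
  g.toBlocks₂₁.map (fun a => (a : ℂ))

/-- See `blkA`. -/
def blkD {n : ℕ} (g : Matrix (Fin n ⊕ Fin n) (Fin n ⊕ Fin n) ℤ) : Matrix (Fin n) (Fin n) ℂ :=
  g.toBlocks₂₂.map (fun a => (a : ℂ))

/-- The function `f|_{ρ,𝓜}[(g,(l,μ;κ))]` on `ℍₙ × ℂ^{(m,n)}`, for an integral symplectic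
similitude `g` with multiplier `ν` and integral `(l,μ;κ)`:
`exp(-2πiν σ(𝓜 W (CΩ+D)⁻¹ C ᵗW)) exp(2πiν σ(𝓜(l Ω ᵗl + 2 l ᵗZ + κ + μ ᵗl)))`
`ρ(CΩ+D)⁻¹ f((AΩ+B)(CΩ+D)⁻¹, ν W (CΩ+D)⁻¹)` with `W = Z + l Ω + μ`.
For `ν = 1` this is the action of the Jacobi group; the factors `ν` are those which make the
action of similitudes compatible with products of matrices, and turn index `𝓜` into `ν𝓜`. -/
def slash {n m : ℕ} {V : Type*} [AddCommGroup V] [Module ℂ V]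
    (ρ : Representation ℂ (GeneralLinearGroup (Fin n) ℂ) V) (𝓜 : Matrix (Fin m) (Fin m) ℝ)
    (ν : ℕ) (g : Matrix (Fin n ⊕ Fin n) (Fin n ⊕ Fin n) ℤ)
    (l μ : Matrix (Fin m) (Fin n) ℤ) (κ : Matrix (Fin m) (Fin m) ℤ)
    (f : Matrix (Fin n) (Fin n) ℂ → Matrix (Fin m) (Fin n) ℂ → V) :
    Matrix (Fin n) (Fin n) ℂ → Matrix (Fin m) (Fin n) ℂ → V := fun Ω Z =>
  let lc : Matrix (Fin m) (Fin n) ℂ := l.map (fun a => (a : ℂ))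
  let μc : Matrix (Fin m) (Fin n) ℂ := μ.map (fun a => (a : ℂ))
  let κc : Matrix (Fin m) (Fin m) ℂ := κ.map (fun a => (a : ℂ))
  let Mc : Matrix (Fin m) (Fin m) ℂ := 𝓜.map (fun a => (a : ℂ))
  let W : Matrix (Fin m) (Fin n) ℂ := Z + lc * Ω + μc
  let j : Matrix (Fin n) (Fin n) ℂ := blkC g * Ω + blkD g
  Complex.exp (-(2 * Real.pi * Complex.I * ν * (Mc * W * j⁻¹ * blkC g * Wᵀ).trace)) •
    Complex.exp (2 * Real.pi * Complex.I * ν *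
        (Mc * (lc * Ω * lcᵀ + (2 : ℂ) • (lc * Zᵀ) + κc + μc * lcᵀ)).trace) •
      repInv ρ j (f ((blkA g * Ω + blkB g) * j⁻¹) ((ν : ℂ) • (W * j⁻¹)))

/-! ### Jacobi forms -/

/-- A real square matrix is half-integral if its diagonal entries and the doubles of all its
entries are integers. -/
def HalfIntegral {k : ℕ} (T : Matrix (Fin k) (Fin k) ℝ) : Prop :=
  (∀ i, ∃ a : ℤ, T i i = a) ∧ ∀ i j, ∃ a : ℤ, 2 * T i j = a

/-- The symmetric semi-positive definite half-integral `n × n` matrices. -/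
abbrev HalfIntPSD (n : ℕ) : Type :=
  {T : Matrix (Fin n) (Fin n) ℝ // T.PosSemidef ∧ HalfIntegral T}

/-- `F` has on `ℍₙ × ℂ^{(m,n)}` a Fourier expansion
`∑ c(T,R) exp((2πi/lam) σ(TΩ)) exp(2πi σ(RZ))`, over half-integral `T ≥ 0` and integral `R`,
with `c(T,R) ≠ 0` only if the matrix with blocks `T/lam`, `R/2`, `ᵗR/2`, `𝓜` is `≥ 0`. -/
def HasJacobiFourier {n m : ℕ} {V : Type*} [NormedAddCommGroup V] [NormedSpace ℂ V]
    (𝓜 : Matrix (Fin m) (Fin m) ℝ) (lam : ℤ)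
    (F : Matrix (Fin n) (Fin n) ℂ → Matrix (Fin m) (Fin n) ℂ → V) : Prop :=
  ∃ c : HalfIntPSD n → Matrix (Fin n) (Fin m) ℤ → V,
    (∀ (T : HalfIntPSD n) (R : Matrix (Fin n) (Fin m) ℤ), c T R ≠ 0 →
      (fromBlocks ((lam : ℝ)⁻¹ • T.1) ((2 : ℝ)⁻¹ • R.map (fun a => (a : ℝ)))
        ((2 : ℝ)⁻¹ • (R.map (fun a => (a : ℝ)))ᵀ) 𝓜).PosSemidef) ∧
    ∀ Ω ∈ siegelH n, ∀ Z : Matrix (Fin m) (Fin n) ℂ,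
      HasSum (fun x : HalfIntPSD n × Matrix (Fin n) (Fin m) ℤ =>
        (Complex.exp (2 * Real.pi * Complex.I / lam *
            (x.1.1.map (fun a => (a : ℂ)) * Ω).trace) *
          Complex.exp (2 * Real.pi * Complex.I * (x.2.map (fun a => (a : ℂ)) * Z).trace)) •
            c x.1 x.2)
        (F Ω Z)

/-- Jacobi forms of index `𝓜` with respect to `ρ` on a subgroup `Γ` of `Γₙ = Sp(n, ℤ)`.
A function on `ℍₙ × ℂ^{(m,n)}` is represented by a function on all pairs of complex matrices of
which only the values on `ℍₙ × ℂ^{(m,n)}` matter. As `ℍₙ` is open in the complex vector space of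
symmetric matrices, `holo` says that `f` is holomorphic there. -/
structure IsJacobiForm {n m : ℕ} {V : Type*} [NormedAddCommGroup V] [NormedSpace ℂ V]
    (ρ : Representation ℂ (GeneralLinearGroup (Fin n) ℂ) V) (𝓜 : Matrix (Fin m) (Fin m) ℝ)
    (Γ : Subgroup (symplecticGroup (Fin n) ℤ))
    (f : Matrix (Fin n) (Fin n) ℂ → Matrix (Fin m) (Fin n) ℂ → V) : Prop where
  holo : DifferentiableOn ℂ
    (fun x : Matrix (Fin n) (Fin n) ℂ × Matrix (Fin m) (Fin n) ℂ => f x.1 x.2)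
    (siegelH n ×ˢ Set.univ)
  invariant : ∀ γ ∈ Γ, ∀ (l μ : Matrix (Fin m) (Fin n) ℤ) (κ : Matrix (Fin m) (Fin m) ℤ),
    (κ + μ * lᵀ).IsSymm → ∀ Ω ∈ siegelH n, ∀ Z : Matrix (Fin m) (Fin n) ℂ,
      slash ρ 𝓜 1 (γ : Matrix (Fin n ⊕ Fin n) (Fin n ⊕ Fin n) ℤ) l μ κ f Ω Z = f Ω Z
  fourier : ∃ lam : ℤ, lam ≠ 0 ∧ ∀ γ : symplecticGroup (Fin n) ℤ,
    HasJacobiFourier 𝓜 lam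
      (slash ρ 𝓜 1 (γ : Matrix (Fin n ⊕ Fin n) (Fin n ⊕ Fin n) ℤ) 0 0 0 f)

/-! ### Cosets and the `p`-Hecke algebra -/

/-- `M` is a symplectic similitude with multiplier `ℓ`, i.e. `M ∈ Oₙ(ℓ)`. (The sign of `J` does
not matter.) -/
def IsSimilitude {n : ℕ} (ℓ : ℕ) (M : Matrix (Fin n ⊕ Fin n) (Fin n ⊕ Fin n) ℤ) : Prop :=
  Mᵀ * J (Fin n) ℤ * M = (ℓ : ℤ) • J (Fin n) ℤ

/-- `O_{n,p}`, the union of the sets `Oₙ(p^l)`, `l ≥ 0`. -/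
abbrev OSet (n p : ℕ) : Type :=
  {M : Matrix (Fin n ⊕ Fin n) (Fin n ⊕ Fin n) ℤ // ∃ l : ℕ, IsSimilitude (p ^ l) M}

/-- The multiplier `p^l` of an element of `O_{n,p}` (unique if `n ≥ 1`). -/
def OSet.mult {n p : ℕ} (M : OSet n p) : ℕ := p ^ M.2.choose

/-- `M ∼ M'` if and only if `Γₙ M = Γₙ M'`. -/
def leftSetoid (n p : ℕ) : Setoid (OSet n p) where
  r M M' := ∃ γ : symplecticGroup (Fin n) ℤ,
    M'.1 = (γ : Matrix (Fin n ⊕ Fin n) (Fin n ⊕ Fin n) ℤ) * M.1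
  iseqv :=
    { refl := fun M => ⟨1, by simp⟩
      symm := by
        rintro M M' ⟨γ, h⟩
        refine ⟨γ⁻¹, ?_⟩
        rw [h, ← Matrix.mul_assoc, ← Submonoid.coe_mul]
        simp
      trans := by
        rintro M M' M'' ⟨γ, h⟩ ⟨γ', h'⟩
        exact ⟨γ' * γ, by rw [h', h, Submonoid.coe_mul, Matrix.mul_assoc]⟩ }

/-- `M ∼ M'` if and only if `Γₙ M Γₙ = Γₙ M' Γₙ`. -/
def doubleSetoid (n p : ℕ) : Setoid (OSet n p) where
  r M M' := ∃ γ γ' : symplecticGroup (Fin n) ℤ,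
    M'.1 = (γ : Matrix (Fin n ⊕ Fin n) (Fin n ⊕ Fin n) ℤ) * M.1 * γ'.1
  iseqv :=
    { refl := fun M => ⟨1, 1, by simp⟩
      symm := by
        rintro M M' ⟨γ, δ, h⟩
        refine ⟨γ⁻¹, δ⁻¹, ?_⟩
        have h1 : (γ⁻¹).1 * γ.1 = 1 := by rw [← Submonoid.coe_mul]; simp
        have h2 : δ.1 * (δ⁻¹).1 = 1 := by rw [← Submonoid.coe_mul]; simp
        calc M.1 = ((γ⁻¹).1 * γ.1) * M.1 * (δ.1 * (δ⁻¹).1) := by rw [h1, h2]; simp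
          _ = _ := by rw [h]; simp only [Matrix.mul_assoc]
      trans := by
        rintro M M' M'' ⟨γ, δ, h⟩ ⟨γ', δ', h'⟩
        exact ⟨γ' * γ, δ * δ', by
          rw [h', h]; simp only [Submonoid.coe_mul, Matrix.mul_assoc]⟩ }

/-- The left cosets `Γₙ M`, `M ∈ O_{n,p}`. -/
abbrev LeftCoset (n p : ℕ) : Type := Quotient (leftSetoid n p)

/-- The double cosets `Γₙ M Γₙ`, `M ∈ O_{n,p}`. -/
abbrev DoubleCoset (n p : ℕ) : Type := Quotient (doubleSetoid n p)

/-- The left coset `Γₙ M`. -/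
def toLeft {n p : ℕ} (M : OSet n p) : LeftCoset n p := Quotient.mk _ M

/-- The double coset `Γₙ M Γₙ`. -/
def toDouble {n p : ℕ} (M : OSet n p) : DoubleCoset n p := Quotient.mk _ M

/-- The left cosets contained in a double coset. -/
def cosetsIn {n p : ℕ} (D : DoubleCoset n p) : Set (LeftCoset n p) :=
  {L | ∃ N : OSet n p, toDouble N = D ∧ toLeft N = L}

theorem toLeft_eq_of_map_eq {n p : ℕ} [Fact p.Prime] {l : ℕ} {M N : OSet n p}
    (hM : IsSimilitude (p ^ l) M.1) (hN : IsSimilitude (p ^ l) N.1)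
    (h : M.1.map (fun a => (a : ZMod (p ^ l))) = N.1.map (fun a => (a : ZMod (p ^ l)))) :
    toLeft M = toLeft N := by
  have hp : ((p ^ l : ℕ) : ℤ) ≠ 0 := by
    exact_mod_cast pow_ne_zero l (Fact.out : p.Prime).ne_zero
  set q : ℕ := p ^ l with hq
  have hJ : J (Fin n) ℤ * J (Fin n) ℤ = -1 := J_squared (Fin n) ℤ
  unfold IsSimilitude at hM hN
  set K : Matrix (Fin n ⊕ Fin n) (Fin n ⊕ Fin n) ℤ := -(J (Fin n) ℤ * M.1ᵀ * J (Fin n) ℤ)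
    with hK
  have hKM : K * M.1 = (q : ℤ) • 1 := by
    have : K * M.1 = -(J (Fin n) ℤ * (M.1ᵀ * J (Fin n) ℤ * M.1)) := by
      simp only [hK, Matrix.neg_mul, Matrix.mul_assoc]
    rw [this, hM, Matrix.mul_smul, hJ]
    simp
  have hdet : M.1.det ≠ 0 := by
    intro h0
    have h1 := congrArg Matrix.det hKM
    rw [Matrix.det_mul, h0, mul_zero, Matrix.det_smul, Matrix.det_one, mul_one] at h1
    exact pow_ne_zero _ hp h1.symm
  have cancel : ∀ X Y : Matrix (Fin n ⊕ Fin n) (Fin n ⊕ Fin n) ℤ,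
      X * M.1 = Y * M.1 → X = Y := by
    intro X Y hXY
    have h1 : X * M.1 * M.1.adjugate = Y * M.1 * M.1.adjugate := by rw [hXY]
    rw [Matrix.mul_assoc, Matrix.mul_assoc, Matrix.mul_adjugate, Matrix.mul_smul,
      Matrix.mul_smul, Matrix.mul_one, Matrix.mul_one] at h1
    exact smul_right_injective _ hdet h1
  have hex : ∃ X : Matrix (Fin n ⊕ Fin n) (Fin n ⊕ Fin n) ℤ, N.1 = M.1 + (q : ℤ) • X := by
    have : ∀ i j, ∃ x : ℤ, N.1 i j = M.1 i j + q * x := by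
      intro i j
      have h1 : ((M.1 i j : ℤ) : ZMod q) = ((N.1 i j : ℤ) : ZMod q) := by
        have := congrFun (congrFun h i) j
        simpa using this
      obtain ⟨x, hx⟩ := ((ZMod.intCast_eq_intCast_iff_dvd_sub _ _ _).1 h1)
      exact ⟨x, by linarith⟩
    choose X hX using this
    refine ⟨Matrix.of X, ?_⟩
    ext i j
    simp [hX]
  obtain ⟨X, hX⟩ := hex
  have hγ : (1 + X * K) * M.1 = N.1 := by
    rw [Matrix.add_mul, Matrix.one_mul, Matrix.mul_assoc, hKM, hX, Matrix.mul_smul,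
      Matrix.mul_one]
  have hmem : (1 + X * K) ∈ symplecticGroup (Fin n) ℤ := by
    rw [SymplecticGroup.mem_iff']
    set γ := 1 + X * K
    have h1 : M.1ᵀ * (γᵀ * J (Fin n) ℤ * γ) * M.1 = M.1ᵀ * J (Fin n) ℤ * M.1 := by
      rw [hM, ← hN, ← hγ]
      simp only [Matrix.transpose_mul, Matrix.mul_assoc]
    have h2 := cancel _ _ h1
    have h3 := congrArg Matrix.transpose h2
    rw [Matrix.transpose_mul, Matrix.transpose_mul M.1ᵀ, Matrix.transpose_transpose] at h3
    exact Matrix.transpose_injective (cancel _ _ h3)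
  exact Quotient.sound ⟨⟨_, hmem⟩, hγ.symm⟩

theorem cosetsIn_finite {n p : ℕ} [Fact p.Prime] (D : DoubleCoset n p) :
    (cosetsIn D).Finite := by
  induction D using Quotient.inductionOn with
  | h M =>
    obtain ⟨l, hl⟩ := M.2
    have hp : p ^ l ≠ 0 := pow_ne_zero l (Fact.out : p.Prime).ne_zero
    have : NeZero (p ^ l) := ⟨hp⟩
    have key : ∀ L ∈ cosetsIn (toDouble M),
        ∃ N : OSet n p, IsSimilitude (p ^ l) N.1 ∧ toLeft N = L := by
      rintro L ⟨N, hN, rfl⟩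
      refine ⟨N, ?_, rfl⟩
      obtain ⟨γ, δ, h⟩ := Quotient.exact hN.symm
      have hγ := SymplecticGroup.mem_iff'.1 γ.2
      have hδ := SymplecticGroup.mem_iff'.1 δ.2
      unfold IsSimilitude at hl ⊢
      rw [h]
      calc (γ.1 * M.1 * δ.1)ᵀ * J (Fin n) ℤ * (γ.1 * M.1 * δ.1)
          = δ.1ᵀ * (M.1ᵀ * (γ.1ᵀ * J (Fin n) ℤ * γ.1) * M.1) * δ.1 := by
            simp only [Matrix.transpose_mul, Matrix.mul_assoc]
        _ = _ := by rw [hγ, hl, Matrix.mul_smul, Matrix.smul_mul, hδ]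
    have : Nonempty (OSet n p) := ⟨M⟩
    choose! r hr hr' using key
    refine Set.Finite.of_finite_image
      (f := fun L => (r L).1.map (fun a => (a : ZMod (p ^ l)))) (Set.toFinite _) ?_
    intro L hL L' hL' h
    rw [← hr' L hL, ← hr' L' hL']
    exact toLeft_eq_of_map_eq (hr L hL) (hr L' hL') h

/-- The `ℂ`-module generated by the left cosets `Γₙ M`, `M ∈ O_{n,p}`. -/
abbrev LeftModule (n p : ℕ) : Type := LeftCoset n p →₀ ℂ

/-- The (underlying `ℂ`-module of the) `p`-Hecke algebra, generated by the double cosets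
`Γₙ M Γₙ`, `M ∈ O_{n,p}`. -/
abbrev HeckeModule (n p : ℕ) : Type := DoubleCoset n p →₀ ℂ

/-- The map `j` sending a double coset to the sum of the left cosets it consists of. -/
def heckeToLeft (n p : ℕ) [Fact p.Prime] : HeckeModule n p →ₗ[ℂ] LeftModule n p :=
  Finsupp.lift (LeftModule n p) ℂ (DoubleCoset n p) (fun D =>
    ∑ L ∈ (cosetsIn_finite D).toFinset, Finsupp.single L (1 : ℂ))

/-- `f|X` for `X` in the module of left cosets: the linear extension of
`f|(Γₙ M) = f|_{ρ,𝓜}[(M,(0,0;0))]`, which for a Jacobi form `f` does not depend on the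
representative `M`. -/
def slashLeft {n m p : ℕ} {V : Type*} [AddCommGroup V] [Module ℂ V]
    (ρ : Representation ℂ (GeneralLinearGroup (Fin n) ℂ) V) (𝓜 : Matrix (Fin m) (Fin m) ℝ)
    (f : Matrix (Fin n) (Fin n) ℂ → Matrix (Fin m) (Fin n) ℂ → V) (X : LeftModule n p) :
    Matrix (Fin n) (Fin n) ℂ → Matrix (Fin m) (Fin n) ℂ → V :=
  X.sum (fun L c => c • slash ρ 𝓜 (Quotient.out L).mult (Quotient.out L).1 0 0 0 f)

/-- `f|T = f|j(T)` for `T` in the `p`-Hecke algebra. -/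
def slashHecke {n m p : ℕ} [Fact p.Prime] {V : Type*} [AddCommGroup V] [Module ℂ V]
    (ρ : Representation ℂ (GeneralLinearGroup (Fin n) ℂ) V) (𝓜 : Matrix (Fin m) (Fin m) ℝ)
    (f : Matrix (Fin n) (Fin n) ℂ → Matrix (Fin m) (Fin n) ℂ → V) (T : HeckeModule n p) :
    Matrix (Fin n) (Fin n) ℂ → Matrix (Fin m) (Fin n) ℂ → V :=
  slashLeft ρ 𝓜 f (heckeToLeft n p T)

/-! ### The Zharkovskaya map -/

/-- The shape of the representatives in degree `N + 1` used to define the Zharkovskaya map: `C = 0`,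
`A` has the form `(a, ᵗα; 0, A*)`, `D` has the form `(d, 0; δ, D*)`, and `d > 0`. -/
structure IsReduced {N : ℕ}
    (M : Matrix (Fin (N + 1) ⊕ Fin (N + 1)) (Fin (N + 1) ⊕ Fin (N + 1)) ℤ) : Prop where
  C_eq : M.toBlocks₂₁ = 0
  A_col : ∀ i : Fin N, M.toBlocks₁₁ i.succ 0 = 0
  D_row : ∀ i : Fin N, M.toBlocks₂₂ 0 i.succ = 0
  d_pos : 0 < M.toBlocks₂₂ 0 0

/-- `M* = (A*, B*; 0, D*)`, where `A*, B*, D*` arise from `A, B, D` by deleting the first row and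
the first column. -/
def starMat {N : ℕ} (M : Matrix (Fin (N + 1) ⊕ Fin (N + 1)) (Fin (N + 1) ⊕ Fin (N + 1)) ℤ) :
    Matrix (Fin N ⊕ Fin N) (Fin N ⊕ Fin N) ℤ :=
  fromBlocks (M.toBlocks₁₁.submatrix Fin.succ Fin.succ) (M.toBlocks₁₂.submatrix Fin.succ Fin.succ)
    0 (M.toBlocks₂₂.submatrix Fin.succ Fin.succ)

theorem isSimilitude_starMat {N ℓ : ℕ}
    {M : Matrix (Fin (N + 1) ⊕ Fin (N + 1)) (Fin (N + 1) ⊕ Fin (N + 1)) ℤ}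
    (hr : IsReduced M) (h : IsSimilitude ℓ M) : IsSimilitude ℓ (starMat M) := by
  obtain ⟨hC, hA, hD, -⟩ := hr
  unfold IsSimilitude at h ⊢
  rw [← Matrix.fromBlocks_toBlocks M, hC] at h
  unfold starMat
  generalize M.toBlocks₁₁ = A at *
  generalize M.toBlocks₁₂ = B at *
  generalize M.toBlocks₂₂ = D at *
  simp only [J, fromBlocks_transpose, fromBlocks_multiply, fromBlocks_smul, fromBlocks_inj] at h ⊢
  obtain ⟨-, h2, h3, h4⟩ := h
  refine ⟨by simp, ?_, ?_, ?_⟩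
  · ext i j
    have := congrFun (congrFun h2 i.succ) j.succ
    simpa [Matrix.mul_apply, Fin.sum_univ_succ, hA, hD, Matrix.one_apply] using this
  · ext i j
    have := congrFun (congrFun h3 i.succ) j.succ
    simpa [Matrix.mul_apply, Fin.sum_univ_succ, hA, hD, Matrix.one_apply] using this
  · ext i j
    have := congrFun (congrFun h4 i.succ) j.succ
    simpa [Matrix.mul_apply, Fin.sum_univ_succ, hA, hD, Matrix.one_apply] using this

/-- `M*` as an element of `O_{N,p}`. -/
def starO {N p : ℕ} (M : OSet (N + 1) p) (hr : IsReduced M.1) : OSet N p :=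
  ⟨starMat M.1, M.2.choose, isSimilitude_starMat hr M.2.choose_spec⟩

open Classical in
/-- `(Γ M)* = d^{-r} Γ M*` for a representative `M` of the coset of the reduced shape. Every coset
contains such a representative, and the result does not depend on it. -/
def starCoset {N p : ℕ} (r : ℤ) (L : LeftCoset (N + 1) p) : LeftModule N p :=
  if h : ∃ M : OSet (N + 1) p, toLeft M = L ∧ IsReduced M.1 then
    Finsupp.single (toLeft (starO h.choose h.choose_spec.2))
      (((h.choose.1.toBlocks₂₂ 0 0 : ℤ) : ℂ) ^ (-r))
  else 0

/-- The linear extension `X ↦ X*` of `(Γ M)* = d^{-r} Γ M*`. -/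
def starLeft {N p : ℕ} (r : ℤ) : LeftModule (N + 1) p →ₗ[ℂ] LeftModule N p :=
  Finsupp.lift (LeftModule N p) ℂ (LeftCoset (N + 1) p) (starCoset r)

/-- `S = T*` under the Zharkovskaya map with parameter `r` from the `p`-Hecke algebra of degree
`N + 1` to that of degree `N`: if `Γ M Γ` is the disjoint union of the `Γ Mⱼ`, then
`(Γ M Γ)* = ∑ⱼ (Γ Mⱼ)*`, where elements of the Hecke algebras are identified with their images
under the injective maps `j`. So there is at most one such `S`. -/
def IsZharkovskaya {N p : ℕ} [Fact p.Prime] (r : ℤ) (T : HeckeModule (N + 1) p)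
    (S : HeckeModule N p) : Prop :=
  heckeToLeft N p S = starLeft r (heckeToLeft (N + 1) p T)

/-! ### The modified Siegel-Jacobi operator -/

/-- The block diagonal matrix `(w, 0; 0, X)`. -/
def diagBlock {N : ℕ} (w : ℂ) (X : Matrix (Fin N) (Fin N) ℂ) :
    Matrix (Fin (N + 1)) (Fin (N + 1)) ℂ :=
  Matrix.of (Fin.cons (Fin.cons w 0) (fun i => Fin.cons 0 (X i)))

theorem diagBlock_mul {N : ℕ} (w w' : ℂ) (X X' : Matrix (Fin N) (Fin N) ℂ) :
    diagBlock w X * diagBlock w' X' = diagBlock (w * w') (X * X') := by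
  ext i j
  refine Fin.cases ?_ (fun i => ?_) i <;> refine Fin.cases ?_ (fun j => ?_) j <;>
    simp [diagBlock, Matrix.mul_apply, Fin.sum_univ_succ]

theorem diagBlock_one {N : ℕ} : diagBlock 1 (1 : Matrix (Fin N) (Fin N) ℂ) = 1 := by
  ext i j
  refine Fin.cases ?_ (fun i => ?_) i <;> refine Fin.cases ?_ (fun j => ?_) j <;>
    simp [diagBlock, Matrix.one_apply, Fin.succ_ne_zero, (Fin.succ_ne_zero _).symm]

/-- The block diagonal matrix `(a, 0; 0, A)` in `GL(N + 1, ℂ)`. -/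
def diagGL {N : ℕ} (a : ℂˣ) (A : GeneralLinearGroup (Fin N) ℂ) :
    GeneralLinearGroup (Fin (N + 1)) ℂ where
  val := diagBlock a A.1
  inv := diagBlock (a⁻¹ : ℂˣ) (A⁻¹).1
  val_inv := by
    rw [diagBlock_mul, Units.mul_inv, show A.1 * (A⁻¹).1 = 1 from A.mul_inv, diagBlock_one]
  inv_val := by
    rw [diagBlock_mul, Units.inv_mul, show (A⁻¹).1 * A.1 = 1 from A.inv_mul, diagBlock_one]

/-- The matrix `(0, Z)`, i.e. `Z` with a zero column added on the left. -/
def zeroCol {m N : ℕ} (Z : Matrix (Fin m) (Fin N) ℂ) : Matrix (Fin m) (Fin (N + 1)) ℂ :=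
  Matrix.of (fun i => Fin.cons 0 (Z i))

/-- The function of `t` whose limit defines the modified Siegel-Jacobi operator. -/
def siegelPath {m N : ℕ} {V : Type*}
    (f : Matrix (Fin (N + 1)) (Fin (N + 1)) ℂ → Matrix (Fin m) (Fin (N + 1)) ℂ → V)
    (Ω : Matrix (Fin N) (Fin N) ℂ) (Z : Matrix (Fin m) (Fin N) ℂ) (t : ℝ) : V :=
  f (diagBlock (Complex.I * t) Ω) (zeroCol Z)

/-- The modified Siegel-Jacobi operator `Ψ⁰_{N+1,N}`:
`(Ψ⁰ f)(Ω, Z) = lim_{t → ∞} f((it, 0; 0, Ω), (0, Z))`. -/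
def siegelJacobi {m N : ℕ} {V : Type*} [NormedAddCommGroup V]
    (f : Matrix (Fin (N + 1)) (Fin (N + 1)) ℂ → Matrix (Fin m) (Fin (N + 1)) ℂ → V) :
    Matrix (Fin N) (Fin N) ℂ → Matrix (Fin m) (Fin N) ℂ → V := fun Ω Z =>
  limUnder atTop (siegelPath f Ω Z)

end SiegelJacobi

end

noncomputable section

namespace SiegelJacobi

open Matrix Filter

/-!
By Hermite reduction every left coset of `Γ_{N+1}` has a representative `M` of Klingen shape. If
`Ω` tends to the cusp along `(it, 0; 0, Ω')`, then `M` sends this path to a path of the same kind,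
up to a bounded shift, over the point `M* Ω'`, so the limit of `f | M` is
`ρ(CΩ + D)⁻¹ (Ψ⁰ f)(M* Ω', ·)` up to the exponential factor. Here `CΩ + D` is the product of a block
diagonal matrix and a lower unipotent one. The intertwiner `R` turns the former into
`d^{-k} ρ₀(D*)⁻¹`, and the latter acts trivially on `Ψ⁰ f`: it does so for integral entries by
the invariance of `f`, hence for all entries because `ρ` is rational. The same computation shows
that `R ∘ Ψ⁰ f` is invariant under `Γ_N`, so that the cosets in `T*` act on it independently of
their representatives. Finally, `T*` exists because the sums of double cosets are exactly the
elements of the module of left cosets invariant under right multiplication by `Γ`.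
-/

section RepInv

variable {n : ℕ} {V : Type*} [AddCommGroup V] [Module ℂ V]
  (ρ : Representation ℂ (GeneralLinearGroup (Fin n) ℂ) V)

theorem repInv_coe (g : GeneralLinearGroup (Fin n) ℂ) (v : V) :
    repInv ρ (g : Matrix (Fin n) (Fin n) ℂ) v = ρ g⁻¹ v := by
  rw [repInv, dif_pos g.isUnit, IsUnit.unit_of_val_units]

theorem repInv_one (v : V) : repInv ρ 1 v = v := by
  simpa using repInv_coe ρ 1 v

theorem repInv_mul {X Y : Matrix (Fin n) (Fin n) ℂ} (hX : IsUnit X) (hY : IsUnit Y) (v : V) :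
    repInv ρ (X * Y) v = repInv ρ Y (repInv ρ X v) := by
  obtain ⟨x, rfl⟩ := hX
  obtain ⟨y, rfl⟩ := hY
  rw [← Units.val_mul, repInv_coe, repInv_coe, repInv_coe, _root_.mul_inv_rev, map_mul,
    Module.End.mul_apply]

theorem isLinearMap_repInv (X : Matrix (Fin n) (Fin n) ℂ) : IsLinearMap ℂ (repInv ρ X) := by
  by_cases hX : IsUnit X
  · obtain ⟨x, rfl⟩ := hX
    simpa only [funext (repInv_coe ρ x)] using (ρ x⁻¹).isLinear
  · have : repInv ρ X = 0 := funext fun v => dif_neg hX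
    exact this ▸ (0 : V →ₗ[ℂ] V).isLinear

end RepInv

section Moebius

variable {n m ℓ : ℕ}

theorem map_intCast_eq_fromBlocks (M : Matrix (Fin n ⊕ Fin n) (Fin n ⊕ Fin n) ℤ) :
    M.map (Int.cast : ℤ → ℂ) = fromBlocks (blkA M) (blkB M) (blkC M) (blkD M) := by
  conv_lhs => rw [← fromBlocks_toBlocks M, fromBlocks_map]
  rfl

theorem fromBlocks_blk_mul (g M : Matrix (Fin n ⊕ Fin n) (Fin n ⊕ Fin n) ℤ) :
    fromBlocks (blkA (g * M)) (blkB (g * M)) (blkC (g * M)) (blkD (g * M)) =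
      fromBlocks (blkA g) (blkB g) (blkC g) (blkD g) *
        fromBlocks (blkA M) (blkB M) (blkC M) (blkD M) := by
  simp only [← map_intCast_eq_fromBlocks]
  exact Matrix.map_mul (f := Int.castRingHom ℂ)

theorem blk_one : blkA (1 : Matrix (Fin n ⊕ Fin n) (Fin n ⊕ Fin n) ℤ) = 1 ∧
    blkB (1 : Matrix (Fin n ⊕ Fin n) (Fin n ⊕ Fin n) ℤ) = 0 ∧
    blkC (1 : Matrix (Fin n ⊕ Fin n) (Fin n ⊕ Fin n) ℤ) = 0 ∧
    blkD (1 : Matrix (Fin n ⊕ Fin n) (Fin n ⊕ Fin n) ℤ) = 1 := by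
  rw [← fromBlocks_inj, fromBlocks_one, ← map_intCast_eq_fromBlocks,
    Matrix.map_one _ Int.cast_zero Int.cast_one]

/-- The numerator `AΩ + B` of the action of `M = (A, B; C, D)`. -/
def num (M : Matrix (Fin n ⊕ Fin n) (Fin n ⊕ Fin n) ℤ) (Ω : Matrix (Fin n) (Fin n) ℂ) :
    Matrix (Fin n) (Fin n) ℂ :=
  blkA M * Ω + blkB M

/-- The denominator `CΩ + D` of the action of `M = (A, B; C, D)`. -/
def denom (M : Matrix (Fin n ⊕ Fin n) (Fin n ⊕ Fin n) ℤ) (Ω : Matrix (Fin n) (Fin n) ℂ) :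
    Matrix (Fin n) (Fin n) ℂ :=
  blkC M * Ω + blkD M

/-- The action `(AΩ + B)(CΩ + D)⁻¹` of `M = (A, B; C, D)` on `ℍₙ`. -/
def moebius (M : Matrix (Fin n ⊕ Fin n) (Fin n ⊕ Fin n) ℤ) (Ω : Matrix (Fin n) (Fin n) ℂ) :
    Matrix (Fin n) (Fin n) ℂ :=
  num M Ω * (denom M Ω)⁻¹

theorem denom_one (Ω : Matrix (Fin n) (Fin n) ℂ) : denom 1 Ω = 1 := by
  rw [denom, blk_one.2.2.1, blk_one.2.2.2, Matrix.zero_mul, zero_add]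

theorem moebius_one (Ω : Matrix (Fin n) (Fin n) ℂ) : moebius 1 Ω = Ω := by
  rw [moebius, denom_one, num, blk_one.1, blk_one.2.1, Matrix.one_mul, add_zero, inv_one,
    Matrix.mul_one]

theorem fromBlocks_blk_mul_fromRows_one (M : Matrix (Fin n ⊕ Fin n) (Fin n ⊕ Fin n) ℤ)
    (Ω : Matrix (Fin n) (Fin n) ℂ) :
    fromBlocks (blkA M) (blkB M) (blkC M) (blkD M) * fromRows Ω (1 : Matrix (Fin n) (Fin n) ℂ) =
      fromRows (num M Ω) (denom M Ω) := by
  rw [fromBlocks_mul_fromRows, Matrix.mul_one, Matrix.mul_one, num, denom]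

theorem num_mul_and_denom_mul {g M : Matrix (Fin n ⊕ Fin n) (Fin n ⊕ Fin n) ℤ}
    {Ω : Matrix (Fin n) (Fin n) ℂ} (h : IsUnit (denom M Ω)) :
    num (g * M) Ω = num g (moebius M Ω) * denom M Ω ∧
      denom (g * M) Ω = denom g (moebius M Ω) * denom M Ω := by
  have hcancel : moebius M Ω * denom M Ω = num M Ω :=
    nonsing_inv_mul_cancel_right _ _ ((isUnit_iff_isUnit_det _).1 h)
  rw [← fromRows_ext_iff, ← fromRows_mul, ← fromBlocks_blk_mul_fromRows_one,
    ← fromBlocks_blk_mul_fromRows_one, fromBlocks_blk_mul, Matrix.mul_assoc, Matrix.mul_assoc,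
    fromBlocks_blk_mul_fromRows_one, fromRows_mul, hcancel, Matrix.one_mul]

theorem moebius_mul {g M : Matrix (Fin n ⊕ Fin n) (Fin n ⊕ Fin n) ℤ}
    {Ω : Matrix (Fin n) (Fin n) ℂ} (h : IsUnit (denom M Ω)) :
    moebius (g * M) Ω = moebius g (moebius M Ω) := by
  obtain ⟨hnum, hdenom⟩ := num_mul_and_denom_mul (g := g) h
  rw [moebius, hnum, hdenom, Matrix.mul_inv_rev, ← Matrix.mul_assoc,
    mul_nonsing_inv_cancel_right _ _ ((isUnit_iff_isUnit_det _).1 h)]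
  rfl

theorem IsSimilitude.transpose_mul_sub_transpose_mul {k k' : Type*}
    {M : Matrix (Fin n ⊕ Fin n) (Fin n ⊕ Fin n) ℤ} (h : IsSimilitude ℓ M)
    (x y : Matrix (Fin n) k ℂ) (x' y' : Matrix (Fin n) k' ℂ) :
    (blkC M * x + blkD M * y)ᵀ * (blkA M * x' + blkB M * y') -
        (blkA M * x + blkB M * y)ᵀ * (blkC M * x' + blkD M * y') =
      (ℓ : ℂ) • (yᵀ * x' - xᵀ * y') := by
  have hJ (u v : Matrix (Fin n) k ℂ) (u' v' : Matrix (Fin n) k' ℂ) :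
      (fromRows u v)ᵀ * (J (Fin n) ℂ * fromRows u' v') = vᵀ * u' - uᵀ * v' := by
    rw [transpose_fromRows, J, fromBlocks_mul_fromRows, fromCols_mul_fromRows]
    simp [neg_add_eq_sub]
  have hM : (M.map (Int.castRingHom ℂ))ᵀ * J (Fin n) ℂ * M.map (Int.castRingHom ℂ) =
      (ℓ : ℂ) • J (Fin n) ℂ := by
    rw [← map_J (Fin n) (Int.castRingHom ℂ), ← transpose_map, ← Matrix.map_mul, ← Matrix.map_mul, h,
      Matrix.map_smul' _ _ _ (map_mul _), map_natCast]
  rw [← hJ, ← hJ, ← Matrix.mul_smul, ← Matrix.smul_mul, ← hM, ← fromBlocks_mul_fromRows,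
    ← fromBlocks_mul_fromRows, ← map_intCast_eq_fromBlocks, transpose_mul]
  simp only [Matrix.mul_assoc]
  rfl

variable {M : Matrix (Fin n ⊕ Fin n) (Fin n ⊕ Fin n) ℤ} {Ω : Matrix (Fin n) (Fin n) ℂ}

theorem IsSimilitude.denom_transpose_mul_num_sub (h : IsSimilitude ℓ M)
    (Ω₁ Ω₂ : Matrix (Fin n) (Fin n) ℂ) :
    (denom M Ω₁)ᵀ * num M Ω₂ - (num M Ω₁)ᵀ * denom M Ω₂ = (ℓ : ℂ) • (Ω₂ - Ω₁ᵀ) := by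
  simpa [num, denom] using h.transpose_mul_sub_transpose_mul Ω₁ 1 Ω₂ 1

theorem IsSimilitude.denom_transpose_mul_blkA_sub (h : IsSimilitude ℓ M)
    (Ω : Matrix (Fin n) (Fin n) ℂ) :
    (denom M Ω)ᵀ * blkA M - (num M Ω)ᵀ * blkC M = (ℓ : ℂ) • 1 := by
  simpa [num, denom] using h.transpose_mul_sub_transpose_mul Ω 1
    (1 : Matrix (Fin n) (Fin n) ℂ) (0 : Matrix (Fin n) (Fin n) ℂ)

theorem conjTranspose_map_intCast (X : Matrix (Fin n) (Fin n) ℤ) :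
    (X.map (Int.cast : ℤ → ℂ))ᴴ = (X.map Int.cast)ᵀ := by
  ext
  simp

theorem conjTranspose_num (M : Matrix (Fin n ⊕ Fin n) (Fin n ⊕ Fin n) ℤ)
    (Ω : Matrix (Fin n) (Fin n) ℂ) : (num M Ω)ᴴ = (num M (Ωᴴᵀ))ᵀ := by
  simp only [num, blkA, blkB, conjTranspose_add, conjTranspose_mul, transpose_add, transpose_mul,
    transpose_transpose, conjTranspose_map_intCast]

theorem conjTranspose_denom (M : Matrix (Fin n ⊕ Fin n) (Fin n ⊕ Fin n) ℤ)
    (Ω : Matrix (Fin n) (Fin n) ℂ) : (denom M Ω)ᴴ = (denom M (Ωᴴᵀ))ᵀ := by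
  simp only [denom, blkC, blkD, conjTranspose_add, conjTranspose_mul, transpose_add, transpose_mul,
    transpose_transpose, conjTranspose_map_intCast]

theorem IsSimilitude.conjTranspose_denom_mul_num_sub (h : IsSimilitude ℓ M)
    (Ω : Matrix (Fin n) (Fin n) ℂ) :
    (denom M Ω)ᴴ * num M Ω - (num M Ω)ᴴ * denom M Ω = (ℓ : ℂ) • (Ω - Ωᴴ) := by
  rw [conjTranspose_denom, conjTranspose_num, h.denom_transpose_mul_num_sub, transpose_transpose]

open scoped MatrixOrder ComplexOrder in
theorem posDef_map_ofReal_iff {ι : Type*} [Finite ι] {Y : Matrix ι ι ℝ} :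
    (Y.map Complex.ofReal).PosDef ↔ Y.PosDef := by
  classical
  have := Fintype.ofFinite ι
  refine ⟨fun h => .of_dotProduct_mulVec_pos (Matrix.ext fun i j => ?_) fun x hx => ?_, fun h => ?_⟩
  · simpa using h.isHermitian.apply i j
  · have hx' : Complex.ofReal ∘ x ≠ 0 := fun h0 => hx <| funext fun i => by
      simpa using congrFun h0 i
    have := h.dotProduct_mulVec_pos hx'
    simp only [dotProduct, mulVec, map_apply, Function.comp_apply, Pi.star_apply, RCLike.star_def,
      Complex.conj_ofReal] at this
    simpa only [dotProduct, mulVec, star_trivial] using mod_cast this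
  · obtain ⟨B, hB, rfl⟩ := CStarAlgebra.isStrictlyPositive_iff_eq_star_mul_self.1
      h.isStrictlyPositive
    have hB' : IsUnit (B.map Complex.ofReal) := hB.map Complex.ofRealHom.mapMatrix
    have hmap : (star B * B).map Complex.ofReal =
        (B.map Complex.ofReal)ᴴ * B.map Complex.ofReal := by
      ext i j
      simp [Matrix.mul_apply, star_eq_conjTranspose]
    exact hmap ▸ .conjTranspose_mul_self _ (mulVec_injective_of_isUnit hB')

open scoped ComplexOrder in
theorem mem_siegelH_iff :
    Ω ∈ siegelH n ↔ Ω.IsSymm ∧ ((2 * Complex.I)⁻¹ • (Ω - Ωᴴ)).PosDef := by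
  refine and_congr_right fun h => ?_
  have : (2 * Complex.I)⁻¹ • (Ω - Ωᴴ) = (Ω.map Complex.im).map Complex.ofReal := by
    ext i j
    simp only [Matrix.smul_apply, Matrix.sub_apply, conjTranspose_apply, h.apply i j, map_apply,
      RCLike.star_def, Complex.sub_conj, smul_eq_mul,
      Complex.ofReal_mul, Complex.ofReal_ofNat]
    field_simp
  rw [this, posDef_map_ofReal_iff]

open scoped ComplexOrder in
theorem IsSimilitude.isUnit_denom (h : IsSimilitude ℓ M) (hℓ : ℓ ≠ 0) (hΩ : Ω ∈ siegelH n) :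
    IsUnit (denom M Ω) := by
  rw [isUnit_iff_isUnit_det, isUnit_iff_ne_zero, Ne, ← exists_mulVec_eq_zero_iff]
  rintro ⟨v, hv, hdv⟩
  have hdv' : star v ᵥ* (denom M Ω)ᴴ = 0 := by rw [← star_mulVec, hdv, star_zero]
  have hY : star v ⬝ᵥ ((Ω - Ωᴴ) *ᵥ v) = 0 := by
    refine (mul_eq_zero_iff_left (Nat.cast_ne_zero.2 hℓ : (ℓ : ℂ) ≠ 0)).1 ?_
    rw [← smul_eq_mul, ← dotProduct_smul, ← smul_mulVec, ← h.conjTranspose_denom_mul_num_sub,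
      sub_mulVec, dotProduct_sub, ← mulVec_mulVec, ← mulVec_mulVec, hdv, mulVec_zero,
      dotProduct_zero, dotProduct_mulVec, hdv', zero_dotProduct, sub_zero]
  have := (mem_siegelH_iff.1 hΩ).2.dotProduct_mulVec_pos hv
  rw [smul_mulVec, dotProduct_smul, hY, smul_zero] at this
  exact this.false

theorem IsSimilitude.moebius_mul_denom (h : IsSimilitude ℓ M) (hℓ : ℓ ≠ 0) (hΩ : Ω ∈ siegelH n) :
    moebius M Ω * denom M Ω = num M Ω :=
  nonsing_inv_mul_cancel_right _ _ ((isUnit_iff_isUnit_det _).1 (h.isUnit_denom hℓ hΩ))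

open scoped ComplexOrder in
theorem IsSimilitude.moebius_mem_siegelH (h : IsSimilitude ℓ M) (hℓ : ℓ ≠ 0) (hΩ : Ω ∈ siegelH n) :
    moebius M Ω ∈ siegelH n := by
  have hu := h.isUnit_denom hℓ hΩ
  have hcancel := h.moebius_mul_denom hℓ hΩ
  have hut : IsUnit (denom M Ω)ᵀ := (isUnit_transpose _).2 hu
  refine mem_siegelH_iff.2 ⟨?_, ?_⟩
  · have hsymm : (denom M Ω)ᵀ * (moebius M Ω)ᵀ * denom M Ω =
        (denom M Ω)ᵀ * moebius M Ω * denom M Ω := by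
      rw [← transpose_mul, Matrix.mul_assoc, hcancel, eq_comm, ← sub_eq_zero,
        h.denom_transpose_mul_num_sub, hΩ.1.eq, sub_self, smul_zero]
    exact hut.mul_left_cancel (hu.mul_right_cancel hsymm)
  · rw [← IsUnit.posDef_star_left_conjugate_iff hu]
    have him : star (denom M Ω) * ((2 * Complex.I)⁻¹ • (moebius M Ω - (moebius M Ω)ᴴ)) *
        denom M Ω = (ℓ : ℂ) • (2 * Complex.I)⁻¹ • (Ω - Ωᴴ) := by
      rw [smul_comm, ← h.conjTranspose_denom_mul_num_sub, ← hcancel, conjTranspose_mul]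
      simp only [star_eq_conjTranspose, Matrix.mul_sub, Matrix.sub_mul, Matrix.mul_smul,
        Matrix.smul_mul, Matrix.mul_assoc]
    rw [him]
    exact (mem_siegelH_iff.1 hΩ).2.smul (by positivity)

end Moebius

section Slash

variable {n m ℓ : ℕ} {V : Type*} [AddCommGroup V] [Module ℂ V]
  (ρ : Representation ℂ (GeneralLinearGroup (Fin n) ℂ) V) (𝓜 : Matrix (Fin m) (Fin m) ℝ)
  {M : Matrix (Fin n ⊕ Fin n) (Fin n ⊕ Fin n) ℤ}
  {f : Matrix (Fin n) (Fin n) ℂ → Matrix (Fin m) (Fin n) ℂ → V}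
  {Ω : Matrix (Fin n) (Fin n) ℂ}

theorem slash_zero (ν : ℕ) (M : Matrix (Fin n ⊕ Fin n) (Fin n ⊕ Fin n) ℤ)
    (f : Matrix (Fin n) (Fin n) ℂ → Matrix (Fin m) (Fin n) ℂ → V)
    (Ω : Matrix (Fin n) (Fin n) ℂ) (Z : Matrix (Fin m) (Fin n) ℂ) :
    slash ρ 𝓜 ν M 0 0 0 f Ω Z =
      Complex.exp (-(2 * Real.pi * Complex.I * ν *
        (𝓜.map Complex.ofReal * Z * (denom M Ω)⁻¹ * blkC M * Zᵀ).trace)) •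
      repInv ρ (denom M Ω) (f (moebius M Ω) ((ν : ℂ) • (Z * (denom M Ω)⁻¹))) := by
  simp [slash, denom, moebius, num, Matrix.map_zero]

theorem slash_one_one (f : Matrix (Fin n) (Fin n) ℂ → Matrix (Fin m) (Fin n) ℂ → V) :
    slash ρ 𝓜 1 1 0 0 0 f = f := by
  funext Ω Z
  simp [slash_zero, denom_one, moebius_one, blk_one.2.2.1, repInv_one]

theorem isSimilitude_one_iff : IsSimilitude 1 M ↔ M ∈ symplecticGroup (Fin n) ℤ := by
  rw [SymplecticGroup.mem_iff', IsSimilitude, Nat.cast_one, one_smul]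

theorem IsSimilitude.blkA_sub_moebius_mul_blkC (h : IsSimilitude ℓ M) (hℓ : ℓ ≠ 0)
    (hΩ : Ω ∈ siegelH n) :
    blkA M - moebius M Ω * blkC M = (ℓ : ℂ) • ((denom M Ω)⁻¹)ᵀ := by
  have hu : IsUnit (denom M Ω)ᵀ := (isUnit_transpose _).2 (h.isUnit_denom hℓ hΩ)
  apply hu.mul_left_cancel
  rw [Matrix.mul_sub, ← Matrix.mul_assoc, ← (h.moebius_mem_siegelH hℓ hΩ).1.eq, ← transpose_mul,
    h.moebius_mul_denom hℓ hΩ, h.denom_transpose_mul_blkA_sub, Matrix.mul_smul,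
    transpose_nonsing_inv, mul_nonsing_inv _ ((isUnit_iff_isUnit_det _).1 hu)]

theorem IsSimilitude.inv_denom_mul_mul_blkC_mul {g : Matrix (Fin n ⊕ Fin n) (Fin n ⊕ Fin n) ℤ}
    (hg : IsUnit (denom g (moebius M Ω))) (h : IsSimilitude ℓ M) (hℓ : ℓ ≠ 0)
    (hΩ : Ω ∈ siegelH n) :
    (denom (g * M) Ω)⁻¹ * blkC (g * M) =
      (ℓ : ℂ) • ((denom M Ω)⁻¹ * (denom g (moebius M Ω))⁻¹ * blkC g * ((denom M Ω)⁻¹)ᵀ) +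
        (denom M Ω)⁻¹ * blkC M := by
  have hblkC : blkC (g * M) = blkC g * (blkA M - moebius M Ω * blkC M) +
      denom g (moebius M Ω) * blkC M := by
    have hmul := fromBlocks_blk_mul g M
    rw [fromBlocks_multiply, fromBlocks_inj] at hmul
    rw [hmul.2.2.1, denom, Matrix.mul_sub, Matrix.add_mul, Matrix.mul_assoc]
    abel
  rw [hblkC, (num_mul_and_denom_mul (h.isUnit_denom hℓ hΩ)).2, h.blkA_sub_moebius_mul_blkC hℓ hΩ,
    Matrix.mul_inv_rev, Matrix.mul_add, Matrix.mul_smul, Matrix.mul_smul, Matrix.mul_assoc _ _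
    (denom g _ * _), nonsing_inv_mul_cancel_left _ _ ((isUnit_iff_isUnit_det _).1 hg)]
  simp only [Matrix.mul_assoc]

theorem slash_mul {ℓ' : ℕ} {g : Matrix (Fin n ⊕ Fin n) (Fin n ⊕ Fin n) ℤ}
    (hg : IsSimilitude ℓ' g) (hℓ' : ℓ' ≠ 0) (h : IsSimilitude ℓ M) (hℓ : ℓ ≠ 0)
    (hΩ : Ω ∈ siegelH n) (Z : Matrix (Fin m) (Fin n) ℂ) :
    slash ρ 𝓜 (ℓ' * ℓ) (g * M) 0 0 0 f Ω Z =
      slash ρ ((ℓ' : ℝ) • 𝓜) ℓ M 0 0 0 (slash ρ 𝓜 ℓ' g 0 0 0 f) Ω Z := by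
  have hjM := h.isUnit_denom hℓ hΩ
  have hjg := hg.isUnit_denom hℓ' (h.moebius_mem_siegelH hℓ hΩ)
  have hmap : ((ℓ' : ℝ) • 𝓜).map Complex.ofReal = (ℓ' : ℂ) • 𝓜.map Complex.ofReal := by
    ext
    simp
  rw [slash_zero, slash_zero, slash_zero, moebius_mul hjM, Matrix.mul_assoc _ _ (blkC (g * M)),
    h.inv_denom_mul_mul_blkC_mul hjg hℓ hΩ, (num_mul_and_denom_mul hjM).2, repInv_mul ρ hjg hjM,
    (isLinearMap_repInv ρ _).map_smul, smul_smul, ← Complex.exp_add, hmap, Matrix.mul_inv_rev]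
  congr 3
  · simp only [Matrix.mul_add, Matrix.add_mul, Matrix.mul_smul, Matrix.smul_mul, trace_add,
      trace_smul, transpose_smul, transpose_mul, smul_eq_mul, Nat.cast_mul, Matrix.mul_assoc]
    ring
  · simp only [Matrix.mul_assoc, Matrix.smul_mul, smul_smul, Nat.cast_mul]

end Slash

section Bordered

variable {N : ℕ} {K : Type*}

/-- The matrix `(a, r; c, X)` obtained from `X` by adding a first row and a first column. -/
def bordered (a : K) (r c : Fin N → K) (X : Matrix (Fin N) (Fin N) K) :
    Matrix (Fin (N + 1)) (Fin (N + 1)) K :=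
  Matrix.of (Fin.cons (Fin.cons a r) fun i => Fin.cons (c i) (X i))

theorem bordered_ext {Y Y' : Matrix (Fin (N + 1)) (Fin (N + 1)) K} (h00 : Y 0 0 = Y' 0 0)
    (hrow : ∀ j : Fin N, Y 0 j.succ = Y' 0 j.succ) (hcol : ∀ i : Fin N, Y i.succ 0 = Y' i.succ 0)
    (hsub : ∀ i j : Fin N, Y i.succ j.succ = Y' i.succ j.succ) : Y = Y' := by
  ext i j
  exact Fin.cases (Fin.cases h00 hrow j) (fun i => Fin.cases (hcol i) (hsub i) j) i

theorem eq_bordered (Y : Matrix (Fin (N + 1)) (Fin (N + 1)) K) :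
    Y = bordered (Y 0 0) (fun j => Y 0 j.succ) (fun i => Y i.succ 0)
      (Y.submatrix Fin.succ Fin.succ) := by
  apply bordered_ext <;> simp [bordered]

theorem bordered_submatrix (a : K) (r c : Fin N → K) (X : Matrix (Fin N) (Fin N) K) :
    (bordered a r c X).submatrix Fin.succ Fin.succ = X := by
  ext
  simp [bordered]

theorem bordered_map {L : Type*} (φ : K → L) (a : K) (r c : Fin N → K)
    (X : Matrix (Fin N) (Fin N) K) :
    (bordered a r c X).map φ = bordered (φ a) (φ ∘ r) (φ ∘ c) (X.map φ) := by
  apply bordered_ext <;> simp [bordered]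

theorem bordered_transpose (a : K) (r c : Fin N → K) (X : Matrix (Fin N) (Fin N) K) :
    (bordered a r c X)ᵀ = bordered a c r Xᵀ := by
  apply bordered_ext <;> simp [bordered]

variable [CommRing K]

theorem bordered_mul (a a' : K) (r c r' c' : Fin N → K) (X X' : Matrix (Fin N) (Fin N) K) :
    bordered a r c X * bordered a' r' c' X' =
      bordered (a * a' + r ⬝ᵥ c') (a • r' + r ᵥ* X') (X *ᵥ c' + a' • c)
        (vecMulVec c r' + X * X') := by
  apply bordered_ext <;> intros <;>
    simp [bordered, Matrix.mul_apply, Fin.sum_univ_succ, dotProduct, vecMul, mulVec,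
      vecMulVec_apply, mul_comm, add_comm]

theorem bordered_add (a a' : K) (r c r' c' : Fin N → K) (X X' : Matrix (Fin N) (Fin N) K) :
    bordered a r c X + bordered a' r' c' X' =
      bordered (a + a') (r + r') (c + c') (X + X') := by
  apply bordered_ext <;> simp [bordered]

theorem bordered_one : bordered (1 : K) 0 0 (1 : Matrix (Fin N) (Fin N) K) = 1 := by
  apply bordered_ext <;> simp [bordered, Matrix.one_apply, (Fin.succ_ne_zero _).symm]

theorem det_bordered_zero_row (a : K) (c : Fin N → K) (X : Matrix (Fin N) (Fin N) K) :
    (bordered a 0 c X).det = a * X.det := by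
  have h0 : bordered a 0 c X 0 0 = a := rfl
  have hrow (j : Fin N) : bordered a 0 c X 0 j.succ = 0 := rfl
  rw [det_succ_row_zero, Fin.sum_univ_succ, Finset.sum_eq_zero fun j _ => by rw [hrow]; ring, h0,
    Fin.succAbove_zero, bordered_submatrix]
  simp

theorem inv_bordered_zero_row {F : Type*} [Field F] {a : F} (ha : a ≠ 0) (c : Fin N → F)
    {X : Matrix (Fin N) (Fin N) F} (hX : IsUnit X) :
    (bordered a 0 c X)⁻¹ = bordered a⁻¹ 0 (-(a⁻¹ • X⁻¹ *ᵥ c)) X⁻¹ := by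
  refine inv_eq_left_inv ?_
  rw [bordered_mul, nonsing_inv_mul _ ((isUnit_iff_isUnit_det _).1 hX), ← bordered_one]
  simp [inv_mul_cancel₀ ha, smul_smul, mul_inv_cancel₀ ha]

/-- The unipotent matrix `(1, 0; x, 1)`. -/
def lowerUnipotent (x : Fin N → K) : Matrix (Fin (N + 1)) (Fin (N + 1)) K :=
  bordered 1 0 x 1

theorem lowerUnipotent_mul (x y : Fin N → K) :
    lowerUnipotent x * lowerUnipotent y = lowerUnipotent (x + y) := by
  simp [lowerUnipotent, bordered_mul, add_comm]

theorem lowerUnipotent_zero : lowerUnipotent (0 : Fin N → K) = 1 :=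
  bordered_one

/-- The unipotent matrix `(1, 0; x, 1)` as an element of `GL(N + 1)`. -/
def lowerUnipotentGL (x : Fin N → K) : GeneralLinearGroup (Fin (N + 1)) K where
  val := lowerUnipotent x
  inv := lowerUnipotent (-x)
  val_inv := by rw [lowerUnipotent_mul, add_neg_cancel, lowerUnipotent_zero]
  inv_val := by rw [lowerUnipotent_mul, neg_add_cancel, lowerUnipotent_zero]

theorem det_lowerUnipotent (x : Fin N → K) : (lowerUnipotent x).det = 1 := by
  rw [lowerUnipotent, det_bordered_zero_row, det_one, mul_one]

end Bordered

section RationalRep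

open Polynomial in
theorem IsRationalRep.exists_polynomial {n : ℕ} {V : Type*} [AddCommGroup V] [Module ℂ V]
    {ρ : Representation ℂ (GeneralLinearGroup (Fin n) ℂ) V} (hρ : IsRationalRep ρ)
    {g : ℂ → GeneralLinearGroup (Fin n) ℂ} {Q : Matrix (Fin n) (Fin n) ℂ[X]}
    (hg : ∀ s, (g s).1 = Q.map (eval s)) (hdet : ∀ s, (g s).1.det = 1) (v : V)
    (φ : Module.Dual ℂ V) : ∃ q : ℂ[X], ∀ s, q.eval s = φ (ρ (g s) v) := by
  obtain ⟨P, e, hP⟩ := hρ v φ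
  refine ⟨MvPolynomial.aeval (fun ij => Q ij.1 ij.2) P, fun s => ?_⟩
  have hs := hP (g s)
  rw [hdet, one_pow, mul_one] at hs
  rw [hs, hg, ← coe_evalRingHom, MvPolynomial.aeval_def, MvPolynomial.hom_eval₂,
    MvPolynomial.eval, MvPolynomial.coe_eval₂Hom]
  congr 1
  ext
  simp

theorem IsRationalRep.apply_lowerUnipotentGL_smul {N : ℕ} {V : Type*} [AddCommGroup V] [Module ℂ V]
    {ρ : Representation ℂ (GeneralLinearGroup (Fin (N + 1)) ℂ) V} (hρ : IsRationalRep ρ)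
    {x : Fin N → ℂ} {v : V} (hv : ∀ n : ℕ, ρ (lowerUnipotentGL ((n : ℂ) • x)) v = v) (s : ℂ) :
    ρ (lowerUnipotentGL (s • x)) v = v := by
  rw [← sub_eq_zero, ← Module.forall_dual_apply_eq_zero_iff ℂ]
  intro φ
  obtain ⟨q, hq⟩ := hρ.exists_polynomial (g := fun s => lowerUnipotentGL (s • x))
    (Q := lowerUnipotent fun i => Polynomial.C (x i) * Polynomial.X)
    (fun s => by
      change lowerUnipotent _ = _
      rw [lowerUnipotent, lowerUnipotent, bordered_map,
        Matrix.map_one _ Polynomial.eval_zero Polynomial.eval_one, Polynomial.eval_one]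
      congr 1
      · ext
        simp
      · ext i
        simp [mul_comm s])
    (fun s => det_lowerUnipotent _) v φ
  have hconst : q = Polynomial.C (φ v) := by
    refine Polynomial.eq_of_infinite_eval_eq _ _ ((Set.infinite_range_of_injective
      (Nat.cast_injective (R := ℂ))).mono ?_)
    rintro _ ⟨n, rfl⟩
    simp only [Set.mem_ofPred_eq, hq, hv, Polynomial.eval_C]
  rw [map_sub, ← hq, hconst, Polynomial.eval_C, sub_self]

end RationalRep

section SiegelLimit

variable {N n m : ℕ}

theorem submatrix_mem_siegelH {k : ℕ} {X : Matrix (Fin n) (Fin n) ℂ} (hX : X ∈ siegelH n)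
    {e : Fin k → Fin n} (he : Function.Injective e) : X.submatrix e e ∈ siegelH k :=
  ⟨hX.1.submatrix e, hX.2.submatrix he⟩

theorem add_single_mem_siegelH {X : Matrix (Fin n) (Fin n) ℂ} (hX : X ∈ siegelH n) (i : Fin n)
    {t : ℝ} (ht : 0 ≤ t) : X + single i i (Complex.I * t) ∈ siegelH n := by
  refine ⟨hX.1.add (by simp [Matrix.IsSymm]), ?_⟩
  have him : (X + single i i (Complex.I * t)).map Complex.im =
      X.map Complex.im + diagonal (Pi.single i t) := by
    rw [diagonal_single, Matrix.map_add _ Complex.add_im]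
    exact congrArg _ ((map_single i i _ Complex.imAddGroupHom).trans (by simp))
  rw [him]
  exact hX.2.add_posSemidef (.diagonal (Pi.single_nonneg.2 ht))

theorem diagBlock_mem_siegelH {Ω : Matrix (Fin N) (Fin N) ℂ} (hΩ : Ω ∈ siegelH N)
    {t : ℝ} (ht : 0 < t) : diagBlock (Complex.I * t) Ω ∈ siegelH (N + 1) := by
  have him : (diagBlock (Complex.I * t) Ω).map Complex.im = bordered t 0 0 (Ω.map Complex.im) := by
    apply bordered_ext <;> simp [diagBlock, bordered]
  refine ⟨(bordered_transpose _ _ _ _).trans (by rw [hΩ.1.eq]; rfl), ?_⟩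
  rw [him]
  refine .of_dotProduct_mulVec_pos ?_ fun x hx => ?_
  · rw [IsHermitian, conjTranspose_eq_transpose_of_trivial, bordered_transpose,
      ← conjTranspose_eq_transpose_of_trivial, hΩ.2.isHermitian.eq]
  have hsplit : star x ⬝ᵥ (bordered t 0 0 (Ω.map Complex.im) *ᵥ x) =
      t * x 0 ^ 2 + star (Fin.tail x) ⬝ᵥ (Ω.map Complex.im *ᵥ Fin.tail x) := by
    simp only [star_trivial, dotProduct, mulVec, Fin.sum_univ_succ, Fin.tail]
    simp only [bordered, of_apply, Fin.cons_zero, Fin.cons_succ, Pi.zero_apply, zero_mul,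
      Finset.sum_const_zero, add_zero, zero_add]
    ring
  rw [hsplit]
  by_cases htail : Fin.tail x = 0
  · have hx0 : x 0 ≠ 0 := fun h0 => hx (funext (Fin.cases h0 (congrFun htail)))
    rw [htail, mulVec_zero, dotProduct_zero, add_zero]
    positivity
  · have := hΩ.2.dotProduct_mulVec_pos htail
    positivity

theorem diagBlock_add (s t : ℂ) (Ω : Matrix (Fin N) (Fin N) ℂ) :
    diagBlock (s + t) Ω = diagBlock s Ω + single 0 0 t := by
  apply bordered_ext <;> simp [diagBlock, (Fin.succ_ne_zero _).symm]

variable {V : Type*} [NormedAddCommGroup V]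
  {f : Matrix (Fin (N + 1)) (Fin (N + 1)) ℂ → Matrix (Fin m) (Fin (N + 1)) ℂ → V}

/-- `Ψ⁰f` is the limit of `f` as the imaginary part of the upper left entry of the first argument
tends to infinity along an arbitrary point, and not only along the points `(it, 0; 0, Ω), (0, Z)`;
in particular the limit depends on neither the first row of `X` nor the first column of `Z`. -/
def HasSiegelLimit
    (f : Matrix (Fin (N + 1)) (Fin (N + 1)) ℂ → Matrix (Fin m) (Fin (N + 1)) ℂ → V) : Prop :=
  ∀ X ∈ siegelH (N + 1), ∀ Z : Matrix (Fin m) (Fin (N + 1)) ℂ,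
    Tendsto (fun t : ℝ => f (X + single 0 0 (Complex.I * t)) Z) atTop
      (𝓝 (siegelJacobi f (X.submatrix Fin.succ Fin.succ) (Z.submatrix id Fin.succ)))

theorem tendsto_siegelPath_of_tendsto {Ω : Matrix (Fin N) (Fin N) ℂ} {Z : Matrix (Fin m) (Fin N) ℂ}
    {y : V} (h : Tendsto (fun t : ℝ => f (diagBlock (Complex.I * (1 : ℝ)) Ω +
      single 0 0 (Complex.I * t)) (zeroCol Z)) atTop (𝓝 y)) :
    Tendsto (siegelPath f Ω Z) atTop (𝓝 y) := by
  refine (h.comp (tendsto_atTop_add_const_right atTop (-1) tendsto_id)).congr fun t => ?_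
  rw [Function.comp_apply, ← diagBlock_add, ← mul_add, ← Complex.ofReal_add, id,
    add_neg_cancel_comm_assoc, siegelPath]

theorem hasSiegelLimit_of_tendsto {G : Matrix (Fin N) (Fin N) ℂ → Matrix (Fin m) (Fin N) ℂ → V}
    (hG : ∀ X ∈ siegelH (N + 1), ∀ Z : Matrix (Fin m) (Fin (N + 1)) ℂ,
      Tendsto (fun t : ℝ => f (X + single 0 0 (Complex.I * t)) Z) atTop
        (𝓝 (G (X.submatrix Fin.succ Fin.succ) (Z.submatrix id Fin.succ)))) :
    HasSiegelLimit f := fun X hX Z => by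
  have hX' := submatrix_mem_siegelH hX (Fin.succ_injective N)
  have hpath := tendsto_siegelPath_of_tendsto
    (hG _ (diagBlock_mem_siegelH hX' one_pos) (zeroCol (Z.submatrix id Fin.succ)))
  rw [siegelJacobi, hpath.limUnder_eq]
  exact hG X hX Z

theorem HasSiegelLimit.tendsto_siegelPath (hf : HasSiegelLimit f) {Ω : Matrix (Fin N) (Fin N) ℂ}
    (hΩ : Ω ∈ siegelH N) (Z : Matrix (Fin m) (Fin N) ℂ) :
    Tendsto (siegelPath f Ω Z) atTop (𝓝 (siegelJacobi f Ω Z)) :=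
  tendsto_siegelPath_of_tendsto (hf _ (diagBlock_mem_siegelH hΩ one_pos) (zeroCol Z))

end SiegelLimit

section Fourier

theorem tendsto_tsum_exp_neg_mul_smul {ι E : Type*} [NormedAddCommGroup E] [NormedSpace ℝ E]
    [CompleteSpace E] {a : ι → ℝ} {u : ι → E} (hu : Summable fun i => ‖u i‖)
    (ha : ∀ i, u i ≠ 0 → 0 ≤ a i) :
    Tendsto (fun t : ℝ => ∑' i, Real.exp (-(a i * t)) • u i) atTop
      (𝓝 (∑' i, if a i = 0 then u i else 0)) := by
  refine tendsto_tsum_of_dominated_convergence hu (fun i => ?_) ?_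
  · split_ifs with hi
    · simp [hi]
    by_cases hui : u i = 0
    · simp [hui]
    have hpos : 0 < a i := (ha i hui).lt_of_ne' hi
    simpa using (Real.tendsto_exp_neg_atTop_nhds_zero.comp
      (tendsto_id.const_mul_atTop hpos)).smul_const (u i)
  · filter_upwards [eventually_ge_atTop 0] with t ht i
    by_cases hui : u i = 0
    · simp [hui]
    rw [norm_smul, Real.norm_eq_abs, Real.abs_exp]
    refine mul_le_of_le_one_left (norm_nonneg _) (Real.exp_le_one_iff.2 ?_)
    exact neg_nonpos.2 (mul_nonneg (ha i hui) ht)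

theorem apply_eq_zero_of_posSemidef {ι : Type*} [Finite ι] {P : Matrix ι ι ℝ}
    (hP : P.PosSemidef) {i : ι} (hi : P i i = 0) (j : ι) : P i j = 0 ∧ P j i = 0 := by
  classical
  have := Fintype.ofFinite ι
  have hcol := (hP.dotProduct_mulVec_zero_iff (Pi.single i 1)).1 (by simp [hi])
  have hji : P j i = 0 := by simpa using congrFun hcol j
  exact ⟨by simpa [hji] using (hP.isHermitian.apply i j).symm, hji⟩

variable {n N m : ℕ}

/-- The exponential `exp((2πi/lam) σ(TΩ)) exp(2πi σ(RZ))` of a Fourier-Jacobi expansion. -/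
def fourierExp (lam : ℤ) (T : Matrix (Fin n) (Fin n) ℝ) (R : Matrix (Fin n) (Fin m) ℤ)
    (Ω : Matrix (Fin n) (Fin n) ℂ) (Z : Matrix (Fin m) (Fin n) ℂ) : ℂ :=
  Complex.exp (2 * Real.pi * Complex.I / lam * (T.map Complex.ofReal * Ω).trace) *
    Complex.exp (2 * Real.pi * Complex.I * (R.map (Int.cast : ℤ → ℂ) * Z).trace)

theorem fourierExp_add_single (lam : ℤ) (T : Matrix (Fin n) (Fin n) ℝ)
    (R : Matrix (Fin n) (Fin m) ℤ) (Ω : Matrix (Fin n) (Fin n) ℂ) (Z : Matrix (Fin m) (Fin n) ℂ)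
    (i : Fin n) (t : ℝ) :
    fourierExp lam T R (Ω + single i i (Complex.I * t)) Z =
      Real.exp (-(2 * Real.pi * ((lam : ℝ)⁻¹ * T i i) * t)) * fourierExp lam T R Ω Z := by
  have hexp : 2 * Real.pi * Complex.I / lam * ((T i i : ℂ) * (Complex.I * t)) =
      ((-(2 * Real.pi * ((lam : ℝ)⁻¹ * T i i) * t) : ℝ) : ℂ) := by
    push_cast
    linear_combination (2 * Real.pi * (lam : ℂ)⁻¹ * T i i * t) * Complex.I_mul_I
  have htrace : (T.map Complex.ofReal * (Ω + single i i (Complex.I * t))).trace =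
      (T.map Complex.ofReal * Ω).trace + T i i * (Complex.I * t) := by
    rw [Matrix.mul_add, trace_add, trace_mul_single]
    simp
  rw [fourierExp, fourierExp, htrace, mul_add, Complex.exp_add, hexp, Complex.ofReal_exp]
  ring

theorem fourierExp_eq_submatrix (lam : ℤ) {T : Matrix (Fin (N + 1)) (Fin (N + 1)) ℝ}
    {R : Matrix (Fin (N + 1)) (Fin m) ℤ} (hT : ∀ j, T 0 j = 0 ∧ T j 0 = 0) (hR : ∀ j, R 0 j = 0)
    (Ω : Matrix (Fin (N + 1)) (Fin (N + 1)) ℂ) (Z : Matrix (Fin m) (Fin (N + 1)) ℂ) :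
    fourierExp lam T R Ω Z = fourierExp lam (T.submatrix Fin.succ Fin.succ)
      (R.submatrix Fin.succ id) (Ω.submatrix Fin.succ Fin.succ) (Z.submatrix id Fin.succ) := by
  simp [fourierExp, trace, Matrix.mul_apply, Fin.sum_univ_succ, (hT _).1, (hT _).2, hR]

theorem fourierExp_eq_submatrix_of_posSemidef {lam : ℤ} {𝓜 : Matrix (Fin m) (Fin m) ℝ}
    {T : Matrix (Fin (N + 1)) (Fin (N + 1)) ℝ} {R : Matrix (Fin (N + 1)) (Fin m) ℤ}
    (hT : T.PosSemidef)
    (hP : (fromBlocks ((lam : ℝ)⁻¹ • T) ((2 : ℝ)⁻¹ • R.map (Int.cast : ℤ → ℝ))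
      ((2 : ℝ)⁻¹ • (R.map (Int.cast : ℤ → ℝ))ᵀ) 𝓜).PosSemidef) (h0 : T 0 0 = 0)
    (Ω : Matrix (Fin (N + 1)) (Fin (N + 1)) ℂ) (Z : Matrix (Fin m) (Fin (N + 1)) ℂ) :
    fourierExp lam T R Ω Z = fourierExp lam (T.submatrix Fin.succ Fin.succ)
      (R.submatrix Fin.succ id) (Ω.submatrix Fin.succ Fin.succ) (Z.submatrix id Fin.succ) := by
  have hR (j : Fin m) : R 0 j = 0 := by
    simpa using (apply_eq_zero_of_posSemidef hP (i := Sum.inl 0) (by simp [h0]) (Sum.inr j)).1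
  exact fourierExp_eq_submatrix lam (apply_eq_zero_of_posSemidef hT h0) hR Ω Z

theorem HasJacobiFourier.hasSiegelLimit {V : Type*} [NormedAddCommGroup V] [NormedSpace ℂ V]
    [FiniteDimensional ℂ V] {𝓜 : Matrix (Fin m) (Fin m) ℝ} {lam : ℤ} (hlam : lam ≠ 0)
    {F : Matrix (Fin (N + 1)) (Fin (N + 1)) ℂ → Matrix (Fin m) (Fin (N + 1)) ℂ → V}
    (hF : HasJacobiFourier 𝓜 lam F) : HasSiegelLimit F := by
  have : FiniteDimensional ℝ V := .complexToReal V
  have : CompleteSpace V := FiniteDimensional.complete ℂ V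
  obtain ⟨c, hc, hsum⟩ := hF
  have hcoeff : ∀ {i}, 2 * Real.pi * ((lam : ℝ)⁻¹ * i) = 0 ↔ i = 0 := by
    simp [Real.pi_ne_zero, hlam]
  refine hasSiegelLimit_of_tendsto (G := fun Ω Z =>
    ∑' x : HalfIntPSD (N + 1) × Matrix (Fin (N + 1)) (Fin m) ℤ, if x.1.1 0 0 = 0 then
      fourierExp lam (x.1.1.submatrix Fin.succ Fin.succ) (x.2.submatrix Fin.succ id) Ω Z • c x.1 x.2
    else 0) fun X hX Z => ?_
  have hlim := tendsto_tsum_exp_neg_mul_smul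
    (a := fun x : HalfIntPSD (N + 1) × Matrix (Fin (N + 1)) (Fin m) ℤ =>
      2 * Real.pi * ((lam : ℝ)⁻¹ * x.1.1 0 0))
    (u := fun x => fourierExp lam x.1.1 x.2 X Z • c x.1 x.2) (hsum X hX Z).summable.norm
    fun x hx => ?nonneg
  case nonneg =>
    have := (hc x.1 x.2 (right_ne_zero_of_smul hx)).diag_nonneg (i := Sum.inl 0)
    exact mul_nonneg Real.two_pi_pos.le (by simpa using this)
  convert hlim.congr' ?_ using 2
  · refine tsum_congr fun x => ?_
    simp only [hcoeff]
    split_ifs with h0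
    · by_cases hx : c x.1 x.2 = 0
      · rw [hx, smul_zero, smul_zero]
      rw [fourierExp_eq_submatrix_of_posSemidef x.1.2.1 (hc x.1 x.2 hx) h0]
    · rfl
  · filter_upwards [eventually_ge_atTop 0] with t ht
    rw [← (hsum _ (add_single_mem_siegelH hX 0 ht) Z).tsum_eq]
    refine tsum_congr fun x => ?_
    rw [← Complex.coe_smul, smul_smul, ← fourierExp_add_single]
    rfl

end Fourier

section Klingen

variable {N : ℕ}

/-- The shape of a matrix which preserves the line spanned by the first standard basis vector and
the span of all standard basis vectors but the one paired with it. -/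
structure IsKlingen (M : Matrix (Fin (N + 1) ⊕ Fin (N + 1)) (Fin (N + 1) ⊕ Fin (N + 1)) ℤ) :
    Prop where
  A_col : ∀ i : Fin N, M (Sum.inl i.succ) (Sum.inl 0) = 0
  C_col : ∀ i : Fin (N + 1), M (Sum.inr i) (Sum.inl 0) = 0
  C_row : ∀ j : Fin (N + 1), M (Sum.inr 0) (Sum.inl j) = 0
  D_row : ∀ j : Fin N, M (Sum.inr 0) (Sum.inr j.succ) = 0

/-- The matrix obtained by deleting the first row and the first column of each block. It extends
`M ↦ M*` to matrices with `C ≠ 0`. -/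
def leviPart (M : Matrix (Fin (N + 1) ⊕ Fin (N + 1)) (Fin (N + 1) ⊕ Fin (N + 1)) ℤ) :
    Matrix (Fin N ⊕ Fin N) (Fin N ⊕ Fin N) ℤ :=
  M.submatrix (Sum.map Fin.succ Fin.succ) (Sum.map Fin.succ Fin.succ)

/-- The embedding `(A, B; C, D) ↦ (1, 0, 0, 0; 0, A, 0, B; 0, 0, 1, 0; 0, C, 0, D)` of degree `N`
into degree `N + 1`. -/
def leviEmbed (γ : Matrix (Fin N ⊕ Fin N) (Fin N ⊕ Fin N) ℤ) :
    Matrix (Fin (N + 1) ⊕ Fin (N + 1)) (Fin (N + 1) ⊕ Fin (N + 1)) ℤ :=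
  fromBlocks (bordered 1 0 0 γ.toBlocks₁₁) (bordered 0 0 0 γ.toBlocks₁₂)
    (bordered 0 0 0 γ.toBlocks₂₁) (bordered 1 0 0 γ.toBlocks₂₂)

variable {ℓ : ℕ} {M M' : Matrix (Fin (N + 1) ⊕ Fin (N + 1)) (Fin (N + 1) ⊕ Fin (N + 1)) ℤ}

theorem IsSimilitude.isKlingen (h : IsSimilitude ℓ M) (hℓ : ℓ ≠ 0)
    (hA : ∀ i : Fin N, M (Sum.inl i.succ) (Sum.inl 0) = 0)
    (hC : ∀ i : Fin (N + 1), M (Sum.inr i) (Sum.inl 0) = 0) : IsKlingen M := by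
  have hcol (j) : M (Sum.inr 0) j * M (Sum.inl 0) (Sum.inl 0) =
      ℓ * (if j = Sum.inr 0 then 1 else 0) := by
    have hj := congrFun (congrFun h j) (Sum.inl 0)
    rcases j with j | j <;>
      simpa [Matrix.mul_apply, J, Fintype.sum_sum_type, Fin.sum_univ_succ, hA, hC,
        Matrix.one_apply, eq_comm] using hj
  have ha : M (Sum.inl 0) (Sum.inl 0) ≠ 0 :=
    right_ne_zero_of_mul ((hcol (Sum.inr 0)).trans_ne (by simpa using hℓ))
  have hrow {j} (hj : j ≠ Sum.inr 0) : M (Sum.inr 0) j = 0 :=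
    (mul_eq_zero.1 ((hcol j).trans (by simp [hj]))).resolve_right ha
  exact ⟨hA, hC, fun j => hrow (by simp), fun j => hrow (by simp)⟩

theorem IsKlingen.D_mul_A (hk : IsKlingen M) (h : IsSimilitude ℓ M) :
    M (Sum.inr 0) (Sum.inr 0) * M (Sum.inl 0) (Sum.inl 0) = ℓ := by
  have := congrFun (congrFun h (Sum.inr 0)) (Sum.inl 0)
  simpa [Matrix.mul_apply, J, Fintype.sum_sum_type, Fin.sum_univ_succ, hk.A_col, hk.C_col]
    using this

theorem IsKlingen.D_ne_zero (hk : IsKlingen M) (h : IsSimilitude ℓ M) (hℓ : ℓ ≠ 0) :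
    M (Sum.inr 0) (Sum.inr 0) ≠ 0 :=
  left_ne_zero_of_mul ((hk.D_mul_A h).trans_ne (Nat.cast_ne_zero.2 hℓ))

theorem IsKlingen.A_div_D_pos (hk : IsKlingen M) (h : IsSimilitude ℓ M) (hℓ : ℓ ≠ 0) :
    0 < (M (Sum.inl 0) (Sum.inl 0) / M (Sum.inr 0) (Sum.inr 0) : ℝ) := by
  have hd : (M (Sum.inr 0) (Sum.inr 0) : ℝ) ≠ 0 := Int.cast_ne_zero.2 (hk.D_ne_zero h hℓ)
  rw [← mul_div_mul_left _ _ hd, ← Int.cast_mul, hk.D_mul_A h]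
  exact div_pos (Nat.cast_pos.2 hℓ.bot_lt) (mul_self_pos.2 hd)

theorem IsKlingen.leviPart_mul (h : IsKlingen M) (h' : IsKlingen M') :
    leviPart (M * M') = leviPart M * leviPart M' := by
  ext (i | i) (j | j) <;>
    simp [leviPart, Matrix.mul_apply, Fintype.sum_sum_type, Fin.sum_univ_succ, h.A_col, h.C_col,
      h'.C_row, h'.D_row]

theorem IsKlingen.mul_apply_inr (h : IsKlingen M) :
    (M * M') (Sum.inr 0) (Sum.inr 0) = M (Sum.inr 0) (Sum.inr 0) * M' (Sum.inr 0) (Sum.inr 0) := by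
  simp [Matrix.mul_apply, Fintype.sum_sum_type, Fin.sum_univ_succ, h.C_row, h.D_row]

theorem IsKlingen.mul (h : IsKlingen M) (h' : IsKlingen M') : IsKlingen (M * M') := by
  constructor <;> intro i <;>
    simp [Matrix.mul_apply, Fintype.sum_sum_type, Fin.sum_univ_succ, h.A_col, h.C_col, h.C_row,
      h.D_row, h'.A_col, h'.C_col, h'.C_row, h'.D_row]

theorem IsKlingen.isSimilitude_leviPart (hk : IsKlingen M) (h : IsSimilitude ℓ M) :
    IsSimilitude ℓ (leviPart M) := by
  ext i j
  have hij := congrFun (congrFun h (Sum.map Fin.succ Fin.succ i)) (Sum.map Fin.succ Fin.succ j)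
  rcases i with i | i <;> rcases j with j | j <;>
    simpa [leviPart, Matrix.mul_apply, J, Fintype.sum_sum_type, Fin.sum_univ_succ, hk.C_row,
      hk.D_row, Matrix.one_apply, Fin.succ_ne_zero, (Fin.succ_ne_zero _).symm] using hij

theorem leviPart_leviEmbed (γ : Matrix (Fin N ⊕ Fin N) (Fin N ⊕ Fin N) ℤ) :
    leviPart (leviEmbed γ) = γ := by
  ext (i | i) (j | j) <;> rfl

theorem isKlingen_leviEmbed (γ : Matrix (Fin N ⊕ Fin N) (Fin N ⊕ Fin N) ℤ) :
    IsKlingen (leviEmbed γ) where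
  A_col _ := rfl
  C_col := Fin.cases rfl fun _ => rfl
  C_row := Fin.cases rfl fun _ => rfl
  D_row _ := rfl

theorem leviEmbed_apply_inr (γ : Matrix (Fin N ⊕ Fin N) (Fin N ⊕ Fin N) ℤ) :
    leviEmbed γ (Sum.inr 0) (Sum.inr 0) = 1 :=
  rfl

theorem leviEmbed_mem_symplecticGroup {γ : Matrix (Fin N ⊕ Fin N) (Fin N ⊕ Fin N) ℤ}
    (hγ : γ ∈ symplecticGroup (Fin N) ℤ) : leviEmbed γ ∈ symplecticGroup (Fin (N + 1)) ℤ := by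
  rw [← fromBlocks_toBlocks γ, SymplecticGroup.fromBlocks_mem_iff] at hγ
  rw [leviEmbed, SymplecticGroup.fromBlocks_mem_iff]
  simp only [bordered_transpose, bordered_mul, zero_dotProduct, mulVec_zero, zero_vecMul,
    smul_zero, add_zero, mul_zero, mul_one, vecMulVec_zero, zero_add]
  refine ⟨by rw [hγ.1], by rw [hγ.2.1], ?_⟩
  rw [sub_eq_iff_eq_add, ← bordered_one, bordered_add, ← hγ.2.2]
  simp

theorem IsReduced.isKlingen (hr : IsReduced M) : IsKlingen M where
  A_col := hr.A_col
  C_col i := congrFun (congrFun hr.C_eq i) 0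
  C_row j := congrFun (congrFun hr.C_eq 0) j
  D_row := hr.D_row

theorem IsReduced.starMat_eq_leviPart (hr : IsReduced M) : starMat M = leviPart M := by
  ext (i | i) (j | j)
  · rfl
  · rfl
  · exact (congrFun (congrFun hr.C_eq i.succ) j.succ).symm
  · rfl

theorem IsKlingen.isReduced (hk : IsKlingen M) (hC : (leviPart M).toBlocks₂₁ = 0)
    (hd : 0 < M (Sum.inr 0) (Sum.inr 0)) : IsReduced M where
  C_eq := by
    ext i j
    refine Fin.cases (hk.C_row j) (fun i => ?_) i
    exact Fin.cases (hk.C_col i.succ) (fun j => congrFun (congrFun hC i) j) j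
  A_col := hk.A_col
  D_row := hk.D_row
  d_pos := hd

end Klingen

section SlashLimit

variable {N m ℓ : ℕ} {M : Matrix (Fin (N + 1) ⊕ Fin (N + 1)) (Fin (N + 1) ⊕ Fin (N + 1)) ℤ}

theorem zeroCol_mul_bordered_zero_row (Z : Matrix (Fin m) (Fin N) ℂ) (a : ℂ) (c : Fin N → ℂ)
    (X : Matrix (Fin N) (Fin N) ℂ) :
    (zeroCol Z * bordered a 0 c X).submatrix id Fin.succ = Z * X := by
  ext i j
  simp [zeroCol, bordered, Matrix.mul_apply, Fin.sum_univ_succ]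

theorem mul_zeroCol {k : ℕ} (A : Matrix (Fin k) (Fin m) ℂ) (Z : Matrix (Fin m) (Fin N) ℂ) :
    A * zeroCol Z = zeroCol (A * Z) := by
  ext i j
  refine Fin.cases ?_ (fun j => ?_) j <;> simp [zeroCol, Matrix.mul_apply]

theorem mul_diagBlock_zero_mul_transpose_zeroCol {k : ℕ} (W : Matrix (Fin k) (Fin (N + 1)) ℂ)
    (C : Matrix (Fin N) (Fin N) ℂ) (Z : Matrix (Fin m) (Fin N) ℂ) :
    W * diagBlock 0 C * (zeroCol Z)ᵀ = W.submatrix id Fin.succ * C * Zᵀ := by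
  ext i j
  simp [diagBlock, zeroCol, Matrix.mul_apply, Fin.sum_univ_succ]

theorem IsKlingen.blkC_eq (hk : IsKlingen M) : blkC M = diagBlock 0 (blkC (leviPart M)) := by
  apply bordered_ext <;> simp [blkC, diagBlock, leviPart, toBlocks₂₁, hk.C_col, hk.C_row]

theorem IsKlingen.blkA_mul_single (hk : IsKlingen M) (c : ℂ) :
    blkA M * single 0 0 c = single 0 0 (M (Sum.inl 0) (Sum.inl 0) * c) := by
  apply bordered_ext <;>
    simp [blkA, Matrix.mul_apply, Fin.sum_univ_succ, toBlocks₁₁, hk.A_col,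
      (Fin.succ_ne_zero _).symm]

theorem IsKlingen.num_diagBlock_submatrix (hk : IsKlingen M) (w : ℂ)
    (Ω : Matrix (Fin N) (Fin N) ℂ) :
    (num M (diagBlock w Ω)).submatrix Fin.succ Fin.succ = num (leviPart M) Ω := by
  ext i j
  simp [num, blkA, blkB, leviPart, diagBlock, Matrix.mul_apply, Fin.sum_univ_succ, toBlocks₁₁,
    toBlocks₁₂, hk.A_col]

theorem IsKlingen.denom_diagBlock (hk : IsKlingen M) (w : ℂ) (Ω : Matrix (Fin N) (Fin N) ℂ) :
    denom M (diagBlock w Ω) = bordered (M (Sum.inr 0) (Sum.inr 0) : ℂ) 0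
      (fun i => M (Sum.inr i.succ) (Sum.inr 0)) (denom (leviPart M) Ω) := by
  rw [denom, hk.blkC_eq, diagBlock_mul, denom]
  apply bordered_ext <;> simp [blkD, bordered, diagBlock, leviPart, toBlocks₂₂, hk.D_row]

theorem IsKlingen.inv_denom_diagBlock (hk : IsKlingen M) (hd : M (Sum.inr 0) (Sum.inr 0) ≠ 0)
    {Ω : Matrix (Fin N) (Fin N) ℂ} (hΩ : IsUnit (denom (leviPart M) Ω)) :
    ∃ e, ∀ w, (denom M (diagBlock w Ω))⁻¹ =
      bordered (M (Sum.inr 0) (Sum.inr 0) : ℂ)⁻¹ 0 e (denom (leviPart M) Ω)⁻¹ :=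
  ⟨_, fun w => by rw [hk.denom_diagBlock, inv_bordered_zero_row (Int.cast_ne_zero.2 hd) _ hΩ]⟩

theorem IsKlingen.moebius_diagBlock_add (hk : IsKlingen M) (hd : M (Sum.inr 0) (Sum.inr 0) ≠ 0)
    {Ω : Matrix (Fin N) (Fin N) ℂ} (hΩ : IsUnit (denom (leviPart M) Ω)) (w c : ℂ) :
    moebius M (diagBlock (w + c) Ω) = moebius M (diagBlock w Ω) +
      single 0 0 (M (Sum.inl 0) (Sum.inl 0) / M (Sum.inr 0) (Sum.inr 0) * c) := by
  obtain ⟨e, he⟩ := hk.inv_denom_diagBlock hd hΩ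
  have hnum : num M (diagBlock (w + c) Ω) =
      num M (diagBlock w Ω) + single 0 0 (M (Sum.inl 0) (Sum.inl 0) * c) := by
    rw [num, num, diagBlock_add, Matrix.mul_add, hk.blkA_mul_single, add_right_comm]
  rw [moebius, moebius, hnum, he, he, Matrix.add_mul]
  congr 1
  apply bordered_ext <;> intros <;>
    simp [bordered, div_eq_mul_inv, mul_right_comm, (Fin.succ_ne_zero _).symm]

theorem IsKlingen.moebius_diagBlock_submatrix (hk : IsKlingen M)
    (hd : M (Sum.inr 0) (Sum.inr 0) ≠ 0) {Ω : Matrix (Fin N) (Fin N) ℂ}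
    (hΩ : IsUnit (denom (leviPart M) Ω)) (w : ℂ) :
    (moebius M (diagBlock w Ω)).submatrix Fin.succ Fin.succ = moebius (leviPart M) Ω := by
  obtain ⟨e, he⟩ := hk.inv_denom_diagBlock hd hΩ
  rw [moebius, he, eq_bordered (num M (diagBlock w Ω)), hk.num_diagBlock_submatrix, bordered_mul,
    bordered_submatrix, vecMulVec_zero, zero_add, moebius]

variable {V : Type*} [NormedAddCommGroup V] [NormedSpace ℂ V] [FiniteDimensional ℂ V]
  {f : Matrix (Fin (N + 1)) (Fin (N + 1)) ℂ → Matrix (Fin m) (Fin (N + 1)) ℂ → V}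

theorem HasSiegelLimit.tendsto_siegelPath_slash (hf : HasSiegelLimit f)
    (ρ : Representation ℂ (GeneralLinearGroup (Fin (N + 1)) ℂ) V) (𝓜 : Matrix (Fin m) (Fin m) ℝ)
    (hk : IsKlingen M) (h : IsSimilitude ℓ M) (hℓ : ℓ ≠ 0) {Ω : Matrix (Fin N) (Fin N) ℂ}
    (hΩ : Ω ∈ siegelH N) (Z : Matrix (Fin m) (Fin N) ℂ) :
    Tendsto (siegelPath (slash ρ 𝓜 ℓ M 0 0 0 f) Ω Z) atTop
      (𝓝 (Complex.exp (-(2 * Real.pi * Complex.I * ℓ * (𝓜.map Complex.ofReal * Z *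
          (denom (leviPart M) Ω)⁻¹ * blkC (leviPart M) * Zᵀ).trace)) •
        repInv ρ (bordered (M (Sum.inr 0) (Sum.inr 0) : ℂ) 0
            (fun i => M (Sum.inr i.succ) (Sum.inr 0)) (denom (leviPart M) Ω))
          (siegelJacobi f (moebius (leviPart M) Ω)
            ((ℓ : ℂ) • (Z * (denom (leviPart M) Ω)⁻¹))))) := by
  have hd := hk.D_ne_zero h hℓ
  have hu := (hk.isSimilitude_leviPart h).isUnit_denom hℓ hΩ
  obtain ⟨e, he⟩ := hk.inv_denom_diagBlock hd hu
  have hlim := (hf _ (h.moebius_mem_siegelH hℓ (diagBlock_mem_siegelH hΩ one_pos))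
    ((ℓ : ℂ) • (zeroCol Z * bordered (M (Sum.inr 0) (Sum.inr 0) : ℂ)⁻¹ 0 e
      (denom (leviPart M) Ω)⁻¹))).comp (tendsto_id.const_mul_atTop (hk.A_div_D_pos h hℓ))
  rw [hk.moebius_diagBlock_submatrix hd hu, submatrix_smul, Pi.smul_apply, Pi.smul_apply,
    zeroCol_mul_bordered_zero_row] at hlim
  have hcont := (isLinearMap_repInv ρ (bordered (M (Sum.inr 0) (Sum.inr 0) : ℂ) 0
    (fun i => M (Sum.inr i.succ) (Sum.inr 0))
    (denom (leviPart M) Ω))).mk'.continuous_of_finiteDimensional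
  refine tendsto_siegelPath_of_tendsto
    ((((hcont.tendsto _).comp hlim).const_smul _).congr fun t => ?_)
  rw [slash_zero, ← diagBlock_add, he, hk.denom_diagBlock, hk.moebius_diagBlock_add hd hu,
    hk.blkC_eq, mul_diagBlock_zero_mul_transpose_zeroCol, mul_zeroCol,
    zeroCol_mul_bordered_zero_row]
  simp [mul_left_comm]

end SlashLimit

section SlashInvariant

/-- The matrix `(ᵗU⁻¹, 0; 0, U)` of the symplectic group. -/
def glEmbed {n : ℕ} {K : Type*} [CommRing K] (U : GeneralLinearGroup (Fin n) K) :
    symplecticGroup (Fin n) K :=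
  ⟨fromBlocks (U⁻¹.1)ᵀ 0 0 U.1, by
    rw [SymplecticGroup.fromBlocks_mem_iff, transpose_transpose,
      show U⁻¹.1 * U.1 = 1 from U.inv_mul]
    simp⟩

/-- `f` is invariant under the action of `Γₙ` of weight `ρ` and index `𝓜`. -/
def IsSlashInvariant {n m : ℕ} {V : Type*} [AddCommGroup V] [Module ℂ V]
    (ρ : Representation ℂ (GeneralLinearGroup (Fin n) ℂ) V) (𝓜 : Matrix (Fin m) (Fin m) ℝ)
    (f : Matrix (Fin n) (Fin n) ℂ → Matrix (Fin m) (Fin n) ℂ → V) : Prop :=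
  ∀ γ : symplecticGroup (Fin n) ℤ, ∀ Ω ∈ siegelH n, ∀ Z, slash ρ 𝓜 1 γ.1 0 0 0 f Ω Z = f Ω Z

variable {N m : ℕ}

theorem isKlingen_glEmbed_lowerUnipotentGL (x : Fin N → ℤ) :
    IsKlingen (glEmbed (lowerUnipotentGL x)).1 :=
  (isSimilitude_one_iff.2 (glEmbed _).2).isKlingen one_ne_zero (fun _ => rfl) fun _ => rfl

theorem leviPart_glEmbed_lowerUnipotentGL (x : Fin N → ℤ) :
    leviPart (glEmbed (lowerUnipotentGL x)).1 = 1 := by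
  have hone : (fromBlocks (1 : Matrix (Fin N) (Fin N) ℤ)ᵀ 0 0 1 :
      Matrix (Fin N ⊕ Fin N) (Fin N ⊕ Fin N) ℤ) = 1 := by
    rw [transpose_one, fromBlocks_one]
  rw [← hone]
  ext (i | i) (j | j) <;> rfl

variable {V V₀ : Type*} [NormedAddCommGroup V] [NormedSpace ℂ V]
  {ρ : Representation ℂ (GeneralLinearGroup (Fin (N + 1)) ℂ) V} {𝓜 : Matrix (Fin m) (Fin m) ℝ}
  {f : Matrix (Fin (N + 1)) (Fin (N + 1)) ℂ → Matrix (Fin m) (Fin (N + 1)) ℂ → V}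
  {Ω : Matrix (Fin N) (Fin N) ℂ}

theorem IsSlashInvariant.siegelPath_slash_eventuallyEq (hinv : IsSlashInvariant ρ 𝓜 f)
    (γ : symplecticGroup (Fin (N + 1)) ℤ) (hΩ : Ω ∈ siegelH N) (Z : Matrix (Fin m) (Fin N) ℂ) :
    siegelPath (slash ρ 𝓜 1 γ.1 0 0 0 f) Ω Z =ᶠ[atTop] siegelPath f Ω Z := by
  filter_upwards [eventually_gt_atTop 0] with t ht
  exact hinv γ _ (diagBlock_mem_siegelH hΩ ht) _

variable [AddCommGroup V₀] [Module ℂ V₀]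
  {ρ₀ : Representation ℂ (GeneralLinearGroup (Fin N) ℂ) V₀} {R : V →ₗ[ℂ] V₀} {k : ℤ}

theorem intertwiner_repInv_diagBlock
    (h1 : ∀ A : GeneralLinearGroup (Fin N) ℂ, R ∘ₗ ρ (diagGL 1 A) = ρ₀ A ∘ₗ R)
    (h2 : ∀ a : ℂˣ, R ∘ₗ ρ (diagGL a 1) = ((a : ℂ) ^ k) • R) {a : ℂ} (ha : a ≠ 0)
    {X : Matrix (Fin N) (Fin N) ℂ} (hX : IsUnit X) (v : V) :
    R (repInv ρ (diagBlock a X) v) = a ^ (-k) • repInv ρ₀ X (R v) := by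
  obtain ⟨A, rfl⟩ := hX
  lift a to ℂˣ using ha.isUnit
  have hR1 (v : V) : R (ρ (diagGL 1 A)⁻¹ v) = ρ₀ A⁻¹ (R v) := LinearMap.congr_fun (h1 A⁻¹) v
  have hR2 (v : V) : R (ρ (diagGL a 1)⁻¹ v) = (a : ℂ) ^ (-k) • R v := by
    have hinv : (diagGL a 1 : GeneralLinearGroup (Fin (N + 1)) ℂ)⁻¹ = diagGL a⁻¹ 1 :=
      Units.ext (congrArg (diagBlock _) (congrArg Units.val (inv_one (G := (_)ˣ))))
    have := LinearMap.congr_fun (h2 a⁻¹) v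
    rwa [← hinv, LinearMap.comp_apply, LinearMap.smul_apply, Units.val_inv_eq_inv_val,
      _root_.inv_zpow, ← _root_.zpow_neg] at this
  have hmul : diagBlock (a : ℂ) A.1 = (diagGL a 1).1 * (diagGL 1 A).1 := by
    simp [diagGL, diagBlock_mul]
  rw [hmul, repInv_mul ρ (Units.isUnit _) (Units.isUnit _), repInv_coe, repInv_coe, repInv_coe,
    hR1, hR2, map_smul]

theorem intertwiner_repInv_bordered
    (h1 : ∀ A : GeneralLinearGroup (Fin N) ℂ, R ∘ₗ ρ (diagGL 1 A) = ρ₀ A ∘ₗ R)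
    (h2 : ∀ a : ℂˣ, R ∘ₗ ρ (diagGL a 1) = ((a : ℂ) ^ k) • R) {d : ℂ} (hd : d ≠ 0)
    {δ : Fin N → ℂ} {X : Matrix (Fin N) (Fin N) ℂ} (hX : IsUnit X) {v : V}
    (hv : ρ (lowerUnipotentGL (d⁻¹ • δ)) v = v) :
    R (repInv ρ (bordered d 0 δ X) v) = d ^ (-k) • repInv ρ₀ X (R v) := by
  have hmul : bordered d 0 δ X = (lowerUnipotentGL (d⁻¹ • δ)).1 * diagBlock d X := by
    change _ = bordered 1 0 _ 1 * bordered d 0 0 X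
    simp [bordered_mul, smul_smul, hd]
  have hdiag : IsUnit (diagBlock d X) := by
    rw [isUnit_iff_isUnit_det, show diagBlock d X = bordered d 0 0 X from rfl,
      det_bordered_zero_row]
    exact hd.isUnit.mul ((isUnit_iff_isUnit_det _).1 hX)
  have hinv : ρ (lowerUnipotentGL (d⁻¹ • δ))⁻¹ v = v := by
    conv_lhs => rw [← hv, ← Module.End.mul_apply, ← map_mul, inv_mul_cancel, map_one]
    rfl
  rw [hmul, repInv_mul ρ (Units.isUnit _) hdiag, repInv_coe, hinv,
    intertwiner_repInv_diagBlock h1 h2 hd hX]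

variable [FiniteDimensional ℂ V]

theorem IsSlashInvariant.apply_lowerUnipotentGL_siegelJacobi (hinv : IsSlashInvariant ρ 𝓜 f)
    (hρ : IsRationalRep ρ) (hf : HasSiegelLimit f) (hΩ : Ω ∈ siegelH N)
    (Z : Matrix (Fin m) (Fin N) ℂ) (x : Fin N → ℤ) (s : ℂ) :
    ρ (lowerUnipotentGL (s • (Int.cast ∘ x))) (siegelJacobi f Ω Z) = siegelJacobi f Ω Z := by
  refine hρ.apply_lowerUnipotentGL_smul (fun n => ?_) s
  have hlim := hf.tendsto_siegelPath_slash ρ 𝓜 (isKlingen_glEmbed_lowerUnipotentGL (n • x))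
    (isSimilitude_one_iff.2 (glEmbed _).2) one_ne_zero hΩ Z
  rw [leviPart_glEmbed_lowerUnipotentGL, denom_one, moebius_one, blk_one.2.2.1] at hlim
  have heq := tendsto_nhds_unique (hf.tendsto_siegelPath hΩ Z)
    (hlim.congr' (hinv.siegelPath_slash_eventuallyEq _ hΩ Z))
  have hX : bordered (((glEmbed (lowerUnipotentGL (n • x))).1 (Sum.inr 0) (Sum.inr 0) : ℤ) : ℂ) 0
      (fun i => ((glEmbed (lowerUnipotentGL (n • x))).1 (Sum.inr i.succ) (Sum.inr 0) : ℤ)) 1 =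
      (lowerUnipotentGL ((n : ℂ) • (Int.cast ∘ x : Fin N → ℂ))).1 := by
    refine congrArg₂ (bordered · 0 · 1) Int.cast_one (funext fun i => ?_)
    change (((n • x) i : ℤ) : ℂ) = _
    simp
  simp only [hX, repInv_coe, Nat.cast_one, Matrix.mul_zero, Matrix.zero_mul, trace_zero, mul_zero,
    neg_zero, Complex.exp_zero, one_smul, inv_one, Matrix.mul_one] at heq
  conv_lhs => rw [heq, ← Module.End.mul_apply, ← map_mul, mul_inv_cancel, map_one]
  rfl

theorem IsSlashInvariant.exists_tendsto_siegelPath_slash (hinv : IsSlashInvariant ρ 𝓜 f)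
    (hρ : IsRationalRep ρ) (hf : HasSiegelLimit f)
    (h1 : ∀ A : GeneralLinearGroup (Fin N) ℂ, R ∘ₗ ρ (diagGL 1 A) = ρ₀ A ∘ₗ R)
    (h2 : ∀ a : ℂˣ, R ∘ₗ ρ (diagGL a 1) = ((a : ℂ) ^ k) • R) {ℓ : ℕ}
    {M : Matrix (Fin (N + 1) ⊕ Fin (N + 1)) (Fin (N + 1) ⊕ Fin (N + 1)) ℤ} (hk : IsKlingen M)
    (h : IsSimilitude ℓ M) (hℓ : ℓ ≠ 0) (hΩ : Ω ∈ siegelH N) (Z : Matrix (Fin m) (Fin N) ℂ) :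
    ∃ v, Tendsto (siegelPath (slash ρ 𝓜 ℓ M 0 0 0 f) Ω Z) atTop (𝓝 v) ∧
      R v = (M (Sum.inr 0) (Sum.inr 0) : ℂ) ^ (-k) •
        slash ρ₀ 𝓜 ℓ (leviPart M) 0 0 0 (fun Ω' Z' => R (siegelJacobi f Ω' Z')) Ω Z := by
  have hstar := hk.isSimilitude_leviPart h
  refine ⟨_, hf.tendsto_siegelPath_slash ρ 𝓜 hk h hℓ hΩ Z, ?_⟩
  rw [map_smul, slash_zero, smul_comm, intertwiner_repInv_bordered h1 h2
    (Int.cast_ne_zero.2 (hk.D_ne_zero h hℓ)) (hstar.isUnit_denom hℓ hΩ)]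
  exact hinv.apply_lowerUnipotentGL_siegelJacobi hρ hf (hstar.moebius_mem_siegelH hℓ hΩ) _
    (fun i => M (Sum.inr i.succ) (Sum.inr 0)) _

theorem IsSlashInvariant.comp_siegelJacobi (hinv : IsSlashInvariant ρ 𝓜 f) (hρ : IsRationalRep ρ)
    (hf : HasSiegelLimit f)
    (h1 : ∀ A : GeneralLinearGroup (Fin N) ℂ, R ∘ₗ ρ (diagGL 1 A) = ρ₀ A ∘ₗ R)
    (h2 : ∀ a : ℂˣ, R ∘ₗ ρ (diagGL a 1) = ((a : ℂ) ^ k) • R) :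
    IsSlashInvariant ρ₀ 𝓜 fun Ω Z => R (siegelJacobi f Ω Z) := by
  intro γ Ω hΩ Z
  have hγ := leviEmbed_mem_symplecticGroup γ.2
  obtain ⟨v, hv, hRv⟩ := hinv.exists_tendsto_siegelPath_slash hρ hf h1 h2
    (isKlingen_leviEmbed γ.1) (isSimilitude_one_iff.2 hγ) one_ne_zero hΩ Z
  rw [leviEmbed_apply_inr, leviPart_leviEmbed, Int.cast_one, _root_.one_zpow,
    one_smul] at hRv
  rw [← hRv, tendsto_nhds_unique hv
    ((hf.tendsto_siegelPath hΩ Z).congr' (hinv.siegelPath_slash_eventuallyEq ⟨_, hγ⟩ hΩ Z).symm)]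

end SlashInvariant

section Transitivity

theorem fromBlocks_diagonal_mem_symplecticGroup {n : ℕ} {K : Type*} [CommRing K]
    {a b c d : Fin n → K}
    (h : ∀ i, a i * d i - b i * c i = 1) :
    fromBlocks (diagonal a) (diagonal b) (diagonal c) (diagonal d) ∈
      symplecticGroup (Fin n) K := by
  rw [SymplecticGroup.fromBlocks_mem_iff]
  simp only [diagonal_transpose, diagonal_mul_diagonal, diagonal_sub]
  refine ⟨by simp only [mul_comm], by simp only [mul_comm], ?_⟩
  rw [← diagonal_one]
  exact congrArg diagonal (funext fun i => by linear_combination h i)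

variable {K : Type*} [CommRing K] [IsDomain K]

theorem exists_det_eq_one_mul_add_mul_eq_zero [IsBezout K] (x y : K) :
    ∃ a b c d : K, a * d - b * c = 1 ∧ c * x + d * y = 0 := by
  by_cases hg : IsBezout.gcd x y = 0
  · have hy : y = 0 := zero_dvd_iff.1 (hg ▸ IsBezout.gcd_dvd_right x y)
    exact ⟨1, 0, 0, 1, by ring, by rw [hy]; ring⟩
  obtain ⟨x', hx⟩ := IsBezout.gcd_dvd_left x y
  obtain ⟨y', hy⟩ := IsBezout.gcd_dvd_right x y
  obtain ⟨u, w, huw⟩ := IsBezout.gcd_eq_sum x y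
  refine ⟨u, w, -y', x', mul_left_cancel₀ hg ?_, ?_⟩
  · linear_combination huw - u * hx - w * hy
  · linear_combination (-y') * hx + x' * hy

variable [IsPrincipalIdealRing K]

theorem exists_basis_eq_smul {ι M : Type*} [Finite ι] [Nonempty ι] [AddCommGroup M] [Module K M]
    (b : Module.Basis ι K M) (x : M) :
    ∃ (b' : Module.Basis ι K M) (i : ι) (c : K), x = c • b' i := by
  by_cases hx : x = 0
  · exact ⟨b, Classical.arbitrary ι, 0, by simp [hx]⟩
  have := Module.Free.of_basis b
  obtain ⟨n, b', bx, φ, a, snf⟩ := Submodule.smithNormalForm b (Submodule.span K {x})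
  have hn : n = 1 := by
    have h1 := (LinearEquiv.toSpanNonzeroSingleton K M x hx).finrank_eq
    rwa [Module.finrank_self, Module.finrank_eq_card_basis bx, Fintype.card_fin, eq_comm] at h1
  subst hn
  refine ⟨b', φ 0, bx.repr ⟨x, Submodule.mem_span_singleton_self x⟩ 0 * a 0, ?_⟩
  rw [mul_smul, ← snf]
  simpa using (congrArg Subtype.val
    (bx.sum_repr ⟨x, Submodule.mem_span_singleton_self x⟩)).symm

variable {N : ℕ}

theorem exists_GL_mulVec_eq_single (x : Fin (N + 1) → K) :
    ∃ (U : GeneralLinearGroup (Fin (N + 1)) K) (g : K), U.1 *ᵥ x = Pi.single 0 g := by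
  obtain ⟨b, i, c, rfl⟩ := exists_basis_eq_smul (Pi.basisFun K (Fin (N + 1))) x
  let e := (b.reindex (Equiv.swap i 0)).equivFun
  refine ⟨GeneralLinearGroup.toLin.symm (LinearMap.GeneralLinearGroup.ofLinearEquiv e), c, ?_⟩
  have he : e (b i) = Pi.single 0 1 := by
    ext j
    simp [e, Pi.single_apply, Finsupp.single_apply, eq_comm]
  change LinearMap.toMatrix' e.toLinearMap *ᵥ _ = _
  rw [LinearMap.toMatrix'_mulVec, map_smul, LinearEquiv.coe_coe, he, ← Pi.single_smul,
    smul_eq_mul, mul_one]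

theorem exists_symplectic_mulVec_eq_single (v : Fin (N + 1) ⊕ Fin (N + 1) → K) :
    ∃ (γ : symplecticGroup (Fin (N + 1)) K) (g : K), γ.1 *ᵥ v = Pi.single (Sum.inl 0) g := by
  choose a b c d h hcd using fun i : Fin (N + 1) =>
    exists_det_eq_one_mul_add_mul_eq_zero (v (Sum.inl i)) (v (Sum.inr i))
  obtain ⟨U, g, hg⟩ := exists_GL_mulVec_eq_single
    fun i => a i * v (Sum.inl i) + b i * v (Sum.inr i)
  have hd : fromBlocks (diagonal a) (diagonal b) (diagonal c) (diagonal d) *ᵥ v =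
      Sum.elim (fun i => a i * v (Sum.inl i) + b i * v (Sum.inr i)) 0 := by
    ext (i | i)
    · simp [fromBlocks_mulVec, mulVec_diagonal]
    · simpa [fromBlocks_mulVec, mulVec_diagonal] using hcd i
  let W : GeneralLinearGroup (Fin (N + 1)) K :=
    ⟨(U⁻¹.1)ᵀ, U.1ᵀ, by rw [← transpose_mul, U.mul_inv, transpose_one],
      by rw [← transpose_mul, U.inv_mul, transpose_one]⟩
  refine ⟨glEmbed W * ⟨_, fromBlocks_diagonal_mem_symplecticGroup h⟩, g, ?_⟩
  have hW : (glEmbed W).1 = fromBlocks U.1 0 0 (U⁻¹.1)ᵀ := rfl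
  rw [Submonoid.coe_mul, ← mulVec_mulVec, hd, hW, fromBlocks_mulVec]
  ext (i | i)
  · simp [hg, Pi.single_apply]
  · simp

end Transitivity

section ReducedRepresentative

theorem IsSimilitude.mul {n ℓ ℓ' : ℕ} {M M' : Matrix (Fin n ⊕ Fin n) (Fin n ⊕ Fin n) ℤ}
    (h : IsSimilitude ℓ M) (h' : IsSimilitude ℓ' M') : IsSimilitude (ℓ * ℓ') (M * M') := by
  unfold IsSimilitude at *
  calc (M * M')ᵀ * J (Fin n) ℤ * (M * M') = M'ᵀ * (Mᵀ * J (Fin n) ℤ * M) * M' := by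
        simp only [Matrix.transpose_mul, Matrix.mul_assoc]
    _ = ((ℓ * ℓ' : ℕ) : ℤ) • J (Fin n) ℤ := by
        rw [h, Matrix.mul_smul, Matrix.smul_mul, h', smul_smul, Nat.cast_mul]

theorem IsSimilitude.symplectic_mul {n ℓ : ℕ} {M : Matrix (Fin n ⊕ Fin n) (Fin n ⊕ Fin n) ℤ}
    (h : IsSimilitude ℓ M) (γ : symplecticGroup (Fin n) ℤ) : IsSimilitude ℓ (γ.1 * M) :=
  one_mul ℓ ▸ (isSimilitude_one_iff.2 γ.2).mul h

theorem IsSimilitude.mul_symplectic {n ℓ : ℕ} {M : Matrix (Fin n ⊕ Fin n) (Fin n ⊕ Fin n) ℤ}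
    (h : IsSimilitude ℓ M) (γ : symplecticGroup (Fin n) ℤ) : IsSimilitude ℓ (M * γ.1) :=
  mul_one ℓ ▸ h.mul (isSimilitude_one_iff.2 γ.2)

variable {N ℓ : ℕ} {M : Matrix (Fin (N + 1) ⊕ Fin (N + 1)) (Fin (N + 1) ⊕ Fin (N + 1)) ℤ}

theorem IsKlingen.neg (hk : IsKlingen M) : IsKlingen (-M) := by
  constructor <;> intro i <;> simp [hk.A_col, hk.C_col, hk.C_row, hk.D_row]

theorem IsSimilitude.exists_isKlingen (h : IsSimilitude ℓ M) (hℓ : ℓ ≠ 0) :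
    ∃ γ : symplecticGroup (Fin (N + 1)) ℤ,
      IsKlingen (γ.1 * M) ∧ 0 < (γ.1 * M) (Sum.inr 0) (Sum.inr 0) := by
  obtain ⟨γ, g, hg⟩ := exists_symplectic_mulVec_eq_single fun i => M i (Sum.inl 0)
  have hcol (i) : (γ.1 * M) i (Sum.inl 0) = (Pi.single (Sum.inl 0) g : _ → ℤ) i :=
    congrFun hg i
  have hγ := h.symplectic_mul γ
  have hk : IsKlingen (γ.1 * M) :=
    hγ.isKlingen hℓ (fun i => by simp [hcol]) fun i => by simp [hcol]
  rcases (hk.D_ne_zero hγ hℓ).lt_or_gt with hneg | hpos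
  · refine ⟨⟨-γ.1, SymplecticGroup.neg_mem γ.2⟩, ?_, ?_⟩ <;> rw [Matrix.neg_mul]
    · exact hk.neg
    · exact neg_pos.2 hneg
  · exact ⟨γ, hk, hpos⟩

theorem IsKlingen.isReduced_leviEmbed_mul (hk : IsKlingen M) (hd : 0 < M (Sum.inr 0) (Sum.inr 0))
    {γ : Matrix (Fin N ⊕ Fin N) (Fin N ⊕ Fin N) ℤ} (hγ : (γ * leviPart M).toBlocks₂₁ = 0) :
    IsReduced (leviEmbed γ * M) := by
  refine ((isKlingen_leviEmbed γ).mul hk).isReduced ?_ ?_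
  · rwa [(isKlingen_leviEmbed γ).leviPart_mul hk, leviPart_leviEmbed]
  · rwa [(isKlingen_leviEmbed γ).mul_apply_inr, leviEmbed_apply_inr, one_mul]

theorem IsSimilitude.exists_isReduced (h : IsSimilitude ℓ M) (hℓ : ℓ ≠ 0) :
    ∃ γ : symplecticGroup (Fin (N + 1)) ℤ, IsReduced (γ.1 * M) := by
  induction N with
  | zero =>
    obtain ⟨γ, hk, hd⟩ := h.exists_isKlingen hℓ
    exact ⟨γ, hk.isReduced (Subsingleton.elim _ _) hd⟩
  | succ N ih =>
    obtain ⟨γ, hk, hd⟩ := h.exists_isKlingen hℓ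
    obtain ⟨γ', hγ'⟩ := ih (hk.isSimilitude_leviPart (h.symplectic_mul γ))
    refine ⟨⟨_, leviEmbed_mem_symplecticGroup γ'.2⟩ * γ, ?_⟩
    rw [Submonoid.coe_mul, Matrix.mul_assoc]
    exact hk.isReduced_leviEmbed_mul hd hγ'.C_eq

end ReducedRepresentative

section LeftCosets

variable {n m p : ℕ} {M M' : OSet n p}

theorem OSet.isSimilitude (M : OSet n p) : IsSimilitude M.mult M.1 := M.2.choose_spec

theorem OSet.mult_ne_zero [Fact p.Prime] (M : OSet n p) : M.mult ≠ 0 :=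
  pow_ne_zero _ (Fact.out : p.Prime).ne_zero

theorem IsSimilitude.unique {ℓ ℓ' : ℕ} {M : Matrix (Fin n ⊕ Fin n) (Fin n ⊕ Fin n) ℤ} (hn : 0 < n)
    (h : IsSimilitude ℓ M) (h' : IsSimilitude ℓ' M) : ℓ = ℓ' := by
  have hentry := congrFun (congrFun (h.symm.trans h') (Sum.inr ⟨0, hn⟩)) (Sum.inl ⟨0, hn⟩)
  simpa [J] using hentry

theorem mult_eq_of_toLeft_eq (hn : 0 < n) (h : toLeft M = toLeft M') : M.mult = M'.mult := by
  obtain ⟨γ, hγ⟩ := Quotient.exact h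
  exact (M.isSimilitude.symplectic_mul γ).unique hn (hγ ▸ M'.isSimilitude)

theorem exists_toLeft_eq_isReduced {N : ℕ} [Fact p.Prime] (L : LeftCoset (N + 1) p) :
    ∃ M : OSet (N + 1) p, toLeft M = L ∧ IsReduced M.1 := by
  obtain ⟨M, rfl⟩ := Quotient.exists_rep L
  obtain ⟨γ, hγ⟩ := M.isSimilitude.exists_isReduced M.mult_ne_zero
  exact ⟨⟨γ.1 * M.1, M.2.choose, M.isSimilitude.symplectic_mul γ⟩,
    (Quotient.sound ⟨γ, rfl⟩ : toLeft M = _).symm, hγ⟩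

variable {V : Type*} [AddCommGroup V] [Module ℂ V]
  {ρ : Representation ℂ (GeneralLinearGroup (Fin n) ℂ) V} {𝓜 : Matrix (Fin m) (Fin m) ℝ}
  {f : Matrix (Fin n) (Fin n) ℂ → Matrix (Fin m) (Fin n) ℂ → V} {Ω : Matrix (Fin n) (Fin n) ℂ}

theorem IsSlashInvariant.slash_symplectic_mul (hinv : IsSlashInvariant ρ 𝓜 f)
    (γ : symplecticGroup (Fin n) ℤ) {ℓ : ℕ} {M : Matrix (Fin n ⊕ Fin n) (Fin n ⊕ Fin n) ℤ}
    (h : IsSimilitude ℓ M) (hℓ : ℓ ≠ 0) (hΩ : Ω ∈ siegelH n) (Z : Matrix (Fin m) (Fin n) ℂ) :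
    slash ρ 𝓜 ℓ (γ.1 * M) 0 0 0 f Ω Z = slash ρ 𝓜 ℓ M 0 0 0 f Ω Z := by
  have hmul := slash_mul (f := f) ρ 𝓜 (isSimilitude_one_iff.2 γ.2) one_ne_zero h hℓ hΩ Z
  rw [one_mul, Nat.cast_one, one_smul] at hmul
  rw [hmul, slash_zero, hinv γ _ (h.moebius_mem_siegelH hℓ hΩ), slash_zero]

theorem IsSlashInvariant.slash_eq_of_toLeft_eq [Fact p.Prime] (hinv : IsSlashInvariant ρ 𝓜 f)
    (hn : 0 < n) (h : toLeft M = toLeft M') (hΩ : Ω ∈ siegelH n) (Z : Matrix (Fin m) (Fin n) ℂ) :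
    slash ρ 𝓜 M'.mult M'.1 0 0 0 f Ω Z = slash ρ 𝓜 M.mult M.1 0 0 0 f Ω Z := by
  obtain ⟨γ, hγ⟩ := Quotient.exact h
  rw [← mult_eq_of_toLeft_eq hn h, hγ]
  exact hinv.slash_symplectic_mul γ M.isSimilitude M.mult_ne_zero hΩ Z

theorem IsSlashInvariant.slashLeft_single [Fact p.Prime] (hinv : IsSlashInvariant ρ 𝓜 f)
    (hn : 0 < n) (M : OSet n p) (c : ℂ) (hΩ : Ω ∈ siegelH n) (Z : Matrix (Fin m) (Fin n) ℂ) :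
    slashLeft ρ 𝓜 f (Finsupp.single (toLeft M) c) Ω Z =
      c • slash ρ 𝓜 M.mult M.1 0 0 0 f Ω Z := by
  rw [slashLeft, Finsupp.sum_single_index (by exact zero_smul ℂ _)]
  exact congrArg (c • ·) (hinv.slash_eq_of_toLeft_eq hn (Quotient.out_eq (toLeft M)).symm hΩ Z)

variable (ρ 𝓜 f) in
theorem slashLeft_zero : slashLeft ρ 𝓜 f (0 : LeftModule n p) = 0 := Finsupp.sum_zero_index

variable (ρ 𝓜 f) in
theorem slashLeft_add (X Y : LeftModule n p) :
    slashLeft ρ 𝓜 f (X + Y) = slashLeft ρ 𝓜 f X + slashLeft ρ 𝓜 f Y :=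
  Finsupp.sum_add_index' (fun _ => zero_smul ℂ _) fun _ _ _ => add_smul _ _ _

end LeftCosets

section HeckeAlgebra

variable {n p : ℕ}

/-- The element `M γ` of `O_{n,p}`, for `γ ∈ Γₙ`. -/
def OSet.mulRight (γ : symplecticGroup (Fin n) ℤ) (M : OSet n p) : OSet n p :=
  ⟨M.1 * γ.1, M.2.choose, M.isSimilitude.mul_symplectic γ⟩

theorem OSet.mulRight_mulRight_of_mul_eq_one {γ δ : symplecticGroup (Fin n) ℤ} (h : γ * δ = 1)
    (M : OSet n p) : OSet.mulRight δ (OSet.mulRight γ M) = M := by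
  refine Subtype.ext ?_
  change M.1 * γ.1 * δ.1 = M.1
  rw [Matrix.mul_assoc, ← Submonoid.coe_mul, h, Submonoid.coe_one, Matrix.mul_one]

theorem OSet.leftSetoid_mulRight (γ : symplecticGroup (Fin n) ℤ) {M M' : OSet n p} :
    leftSetoid n p M M' → leftSetoid n p (M.mulRight γ) (M'.mulRight γ) :=
  fun ⟨δ, h⟩ => ⟨δ, by simp only [OSet.mulRight, h, Matrix.mul_assoc]⟩

namespace LeftCoset

/-- The permutation `Γₙ M ↦ Γₙ M γ` of the left cosets, for `γ ∈ Γₙ`. -/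
def mulRight (γ : symplecticGroup (Fin n) ℤ) : Equiv.Perm (LeftCoset n p) where
  toFun := Quotient.map (OSet.mulRight γ) fun _ _ => OSet.leftSetoid_mulRight γ
  invFun := Quotient.map (OSet.mulRight γ⁻¹) fun _ _ => OSet.leftSetoid_mulRight γ⁻¹
  left_inv := Quotient.ind fun M =>
    congrArg toLeft (M.mulRight_mulRight_of_mul_eq_one (mul_inv_cancel γ))
  right_inv := Quotient.ind fun M =>
    congrArg toLeft (M.mulRight_mulRight_of_mul_eq_one (inv_mul_cancel γ))

/-- The double coset `Γₙ M Γₙ` containing the left coset `Γₙ M`. -/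
def toDouble : LeftCoset n p → DoubleCoset n p :=
  Quotient.map id fun _ _ ⟨γ, h⟩ => ⟨γ, 1, by simpa using h⟩

theorem mem_cosetsIn {D : DoubleCoset n p} {L : LeftCoset n p} :
    L ∈ cosetsIn D ↔ L.toDouble = D := by
  constructor
  · rintro ⟨M, rfl, rfl⟩
    rfl
  · obtain ⟨M, rfl⟩ := Quotient.exists_rep L
    rintro rfl
    exact ⟨M, rfl, rfl⟩

theorem toDouble_mulRight (γ : symplecticGroup (Fin n) ℤ) (L : LeftCoset n p) :
    (mulRight γ L).toDouble = L.toDouble := by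
  obtain ⟨M, rfl⟩ := Quotient.exists_rep L
  exact (Quotient.sound ⟨1, γ, by simp [OSet.mulRight]⟩ :
    SiegelJacobi.toDouble M = SiegelJacobi.toDouble (M.mulRight γ)).symm

theorem exists_mulRight_eq {L L' : LeftCoset n p} (h : L.toDouble = L'.toDouble) :
    ∃ γ, mulRight γ L = L' := by
  obtain ⟨M, rfl⟩ := Quotient.exists_rep L
  obtain ⟨M', rfl⟩ := Quotient.exists_rep L'
  obtain ⟨γ, δ, hM'⟩ : ∃ γ δ : symplecticGroup (Fin n) ℤ, M'.1 = γ.1 * M.1 * δ.1 :=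
    Quotient.exact h
  exact ⟨δ, Quotient.sound ⟨γ, by simp only [hM', OSet.mulRight, Matrix.mul_assoc]⟩⟩

end LeftCoset

variable [Fact p.Prime]

theorem heckeToLeft_apply (T : HeckeModule n p) (L : LeftCoset n p) :
    heckeToLeft n p T L = T L.toDouble := by
  classical
  induction T using Finsupp.induction_linear with
  | zero => simp
  | add S T hS hT => simp [hS, hT]
  | single D c =>
    simp [heckeToLeft, Finsupp.single_apply, Set.Finite.mem_toFinset, LeftCoset.mem_cosetsIn,
      eq_comm]

theorem exists_heckeToLeft_eq_iff {X : LeftModule n p} :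
    (∃ T, heckeToLeft n p T = X) ↔ ∀ γ, X.mapDomain (LeftCoset.mulRight γ) = X := by
  classical
  constructor
  · rintro ⟨T, rfl⟩ γ
    ext L
    rw [Finsupp.mapDomain_equiv_apply, heckeToLeft_apply, heckeToLeft_apply,
      ← LeftCoset.toDouble_mulRight γ, Equiv.apply_symm_apply]
  · intro hX
    have hconst {L L' : LeftCoset n p} (h : L.toDouble = L'.toDouble) : X L = X L' := by
      obtain ⟨γ, rfl⟩ := LeftCoset.exists_mulRight_eq h
      rw [← DFunLike.congr_fun (hX γ) (LeftCoset.mulRight γ L),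
        Finsupp.mapDomain_apply (LeftCoset.mulRight γ).injective]
    refine ⟨Finsupp.onFinset (X.support.image LeftCoset.toDouble)
      (fun D => X (toLeft (Quotient.out D))) fun D hD => ?_, ?_⟩
    · exact Finset.mem_image.2 ⟨_, Finsupp.mem_support_iff.2 hD, Quotient.out_eq D⟩
    · ext L
      rw [heckeToLeft_apply, Finsupp.onFinset_apply]
      exact hconst (Quotient.out_eq L.toDouble)

end HeckeAlgebra

section Zharkovskaya

theorem IsKlingen.of_mul_right {N ℓ ℓ' : ℕ}
    {γ M : Matrix (Fin (N + 1) ⊕ Fin (N + 1)) (Fin (N + 1) ⊕ Fin (N + 1)) ℤ} (hk : IsKlingen M)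
    (h : IsSimilitude ℓ M) (hℓ : ℓ ≠ 0) (hγ : IsSimilitude ℓ' γ) (hℓ' : ℓ' ≠ 0)
    (hmul : IsKlingen (γ * M)) : IsKlingen γ := by
  have ha : M (Sum.inl 0) (Sum.inl 0) ≠ 0 := fun h0 => hℓ (by simpa [h0] using (hk.D_mul_A h).symm)
  have hcol (i) : (γ * M) i (Sum.inl 0) = γ i (Sum.inl 0) * M (Sum.inl 0) (Sum.inl 0) := by
    simp [Matrix.mul_apply, Fintype.sum_sum_type, Fin.sum_univ_succ, hk.A_col, hk.C_col]
  have hzero {i} (hi : (γ * M) i (Sum.inl 0) = 0) : γ i (Sum.inl 0) = 0 :=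
    (mul_eq_zero.1 ((hcol i).symm.trans hi)).resolve_right ha
  exact hγ.isKlingen hℓ' (fun i => hzero (hmul.A_col i)) fun i => hzero (hmul.C_col i)

variable {N p : ℕ}

/-- The element of `O_{N,p}` given by the Levi part of a matrix of Klingen shape. -/
def OSet.leviPart (M : OSet (N + 1) p) (hk : IsKlingen M.1) : OSet N p :=
  ⟨SiegelJacobi.leviPart M.1, M.2.choose, hk.isSimilitude_leviPart M.isSimilitude⟩

theorem starO_eq_leviPart {M : OSet (N + 1) p} (hr : IsReduced M.1) :
    starO M hr = M.leviPart hr.isKlingen := Subtype.ext hr.starMat_eq_leviPart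

theorem starLeft_single (r : ℤ) (L : LeftCoset (N + 1) p) (c : ℂ) :
    starLeft r (Finsupp.single L c) = c • starCoset r L := by
  simp [starLeft]

/-- The embedding `leviEmbed` as a map `Γ_N → Γ_{N+1}`. -/
def symplecticLeviEmbed (γ : symplecticGroup (Fin N) ℤ) : symplecticGroup (Fin (N + 1)) ℤ :=
  ⟨leviEmbed γ.1, leviEmbed_mem_symplecticGroup γ.2⟩

variable [Fact p.Prime]

theorem OSet.toLeft_leviPart_eq {M M' : OSet (N + 1) p} (hk : IsKlingen M.1)
    (hk' : IsKlingen M'.1) (hd : 0 < M.1 (Sum.inr 0) (Sum.inr 0))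
    (hd' : 0 < M'.1 (Sum.inr 0) (Sum.inr 0)) (h : toLeft M = toLeft M') :
    toLeft (M.leviPart hk) = toLeft (M'.leviPart hk') ∧
      M.1 (Sum.inr 0) (Sum.inr 0) = M'.1 (Sum.inr 0) (Sum.inr 0) := by
  obtain ⟨γ, hγ : M'.1 = γ.1 * M.1⟩ := Quotient.exact h
  have hγ1 := isSimilitude_one_iff.2 γ.2
  have hkγ : IsKlingen γ.1 :=
    hk.of_mul_right M.isSimilitude M.mult_ne_zero hγ1 one_ne_zero (hγ ▸ hk')
  constructor
  · refine Quotient.sound ⟨⟨SiegelJacobi.leviPart γ.1,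
      isSimilitude_one_iff.1 (hkγ.isSimilitude_leviPart hγ1)⟩, ?_⟩
    change SiegelJacobi.leviPart M'.1 = SiegelJacobi.leviPart γ.1 * SiegelJacobi.leviPart M.1
    rw [hγ, hkγ.leviPart_mul hk]
  · have hpos : 0 < γ.1 (Sum.inr 0) (Sum.inr 0) := by
      rw [hγ, hkγ.mul_apply_inr] at hd'
      exact pos_of_mul_pos_left hd' hd.le
    have hone : γ.1 (Sum.inr 0) (Sum.inr 0) = 1 :=
      Int.eq_one_of_mul_eq_one_right hpos.le (by simpa using hkγ.D_mul_A hγ1)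
    rw [hγ, hkγ.mul_apply_inr, hone, one_mul]

theorem starCoset_toLeft (r : ℤ) {M : OSet (N + 1) p} (hk : IsKlingen M.1)
    (hd : 0 < M.1 (Sum.inr 0) (Sum.inr 0)) :
    starCoset r (toLeft M) =
      Finsupp.single (toLeft (M.leviPart hk)) ((M.1 (Sum.inr 0) (Sum.inr 0) : ℂ) ^ (-r)) := by
  have h := exists_toLeft_eq_isReduced (toLeft M)
  obtain ⟨hM, hr⟩ := h.choose_spec
  obtain ⟨hlevi, hd'⟩ := OSet.toLeft_leviPart_eq hr.isKlingen hk hr.d_pos hd hM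
  rw [starCoset, dif_pos h, starO_eq_leviPart, hlevi, ← hd']
  rfl

theorem starCoset_mulRight (r : ℤ) (γ : symplecticGroup (Fin N) ℤ) (L : LeftCoset (N + 1) p) :
    starCoset r (LeftCoset.mulRight (symplecticLeviEmbed γ) L) =
      (starCoset r L).mapDomain (LeftCoset.mulRight γ) := by
  obtain ⟨M, rfl, hr⟩ := exists_toLeft_eq_isReduced L
  have hkγ := isKlingen_leviEmbed γ.1
  have hk : IsKlingen (M.mulRight (symplecticLeviEmbed γ)).1 := hr.isKlingen.mul hkγ
  have hd : (M.mulRight (symplecticLeviEmbed γ)).1 (Sum.inr 0) (Sum.inr 0) =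
      M.1 (Sum.inr 0) (Sum.inr 0) := by
    change (M.1 * leviEmbed γ.1) _ _ = _
    rw [hr.isKlingen.mul_apply_inr, leviEmbed_apply_inr, mul_one]
  have hlevi : (M.mulRight (symplecticLeviEmbed γ)).leviPart hk =
      (M.leviPart hr.isKlingen).mulRight γ := by
    refine Subtype.ext ?_
    change leviPart (M.1 * leviEmbed γ.1) = leviPart M.1 * γ.1
    rw [hr.isKlingen.leviPart_mul hkγ, leviPart_leviEmbed]
  change starCoset r (toLeft (M.mulRight _)) = _
  rw [starCoset_toLeft r hk (hd ▸ hr.d_pos), starCoset_toLeft r hr.isKlingen hr.d_pos,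
    Finsupp.mapDomain_single, hd, hlevi]
  rfl

theorem starLeft_mapDomain_mulRight (r : ℤ) (γ : symplecticGroup (Fin N) ℤ)
    (X : LeftModule (N + 1) p) :
    starLeft r (X.mapDomain (LeftCoset.mulRight (symplecticLeviEmbed γ))) =
      (starLeft r X).mapDomain (LeftCoset.mulRight γ) := by
  induction X using Finsupp.induction_linear with
  | zero => simp
  | add X Y hX hY => simp only [Finsupp.mapDomain_add, map_add, hX, hY]
  | single L c =>
    rw [Finsupp.mapDomain_single, starLeft_single, starLeft_single, starCoset_mulRight,
      Finsupp.mapDomain_smul]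

theorem exists_isZharkovskaya (r : ℤ) (T : HeckeModule (N + 1) p) :
    ∃ S : HeckeModule N p, IsZharkovskaya r T S := by
  refine exists_heckeToLeft_eq_iff.2 fun γ => ?_
  rw [← starLeft_mapDomain_mulRight, exists_heckeToLeft_eq_iff.1 ⟨T, rfl⟩]

end Zharkovskaya

section Commutation

variable {N m p : ℕ} {V V₀ : Type*} [NormedAddCommGroup V] [NormedSpace ℂ V]
  [FiniteDimensional ℂ V] [AddCommGroup V₀] [Module ℂ V₀] {𝓜 : Matrix (Fin m) (Fin m) ℝ}
  {ρ : Representation ℂ (GeneralLinearGroup (Fin (N + 1)) ℂ) V}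
  {ρ₀ : Representation ℂ (GeneralLinearGroup (Fin N) ℂ) V₀} {R : V →ₗ[ℂ] V₀} {k : ℤ}
  {f : Matrix (Fin (N + 1)) (Fin (N + 1)) ℂ → Matrix (Fin m) (Fin (N + 1)) ℂ → V}

theorem IsSlashInvariant.exists_tendsto_siegelPath_slashLeft [Fact p.Prime]
    (hinv : IsSlashInvariant ρ 𝓜 f) (hN : 1 ≤ N) (hρ : IsRationalRep ρ) (hf : HasSiegelLimit f)
    (h1 : ∀ A : GeneralLinearGroup (Fin N) ℂ, R ∘ₗ ρ (diagGL 1 A) = ρ₀ A ∘ₗ R)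
    (h2 : ∀ a : ℂˣ, R ∘ₗ ρ (diagGL a 1) = ((a : ℂ) ^ k) • R) (X : LeftModule (N + 1) p)
    {Ω : Matrix (Fin N) (Fin N) ℂ} (hΩ : Ω ∈ siegelH N) (Z : Matrix (Fin m) (Fin N) ℂ) :
    ∃ v, Tendsto (siegelPath (slashLeft ρ 𝓜 f X) Ω Z) atTop (𝓝 v) ∧
      R v = slashLeft ρ₀ 𝓜 (fun Ω' Z' => R (siegelJacobi f Ω' Z')) (starLeft k X) Ω Z := by
  induction X using Finsupp.induction_linear with
  | zero =>
    refine ⟨0, ?_, by rw [map_zero, map_zero, slashLeft_zero]; rfl⟩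
    rw [slashLeft_zero]
    exact tendsto_const_nhds
  | add X Y hX hY =>
    obtain ⟨v, hv, hRv⟩ := hX
    obtain ⟨w, hw, hRw⟩ := hY
    refine ⟨v + w, ?_, by rw [map_add, map_add, slashLeft_add, hRv, hRw]; rfl⟩
    rw [slashLeft_add]
    exact hv.add hw
  | single L c =>
    obtain ⟨M, rfl, hr⟩ := exists_toLeft_eq_isReduced L
    have hM := M.isSimilitude
    obtain ⟨v, hv, hRv⟩ := hinv.exists_tendsto_siegelPath_slash hρ hf h1 h2 hr.isKlingen hM
      M.mult_ne_zero hΩ Z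
    refine ⟨c • v, (hv.const_smul c).congr' ?_, ?_⟩
    · filter_upwards [eventually_gt_atTop 0] with t ht
      exact (hinv.slashLeft_single N.succ_pos M c (diagBlock_mem_siegelH hΩ ht) _).symm
    · have hmult : (M.leviPart hr.isKlingen).mult = M.mult :=
        (OSet.isSimilitude _).unique hN (hr.isKlingen.isSimilitude_leviPart hM)
      rw [starLeft_single, starCoset_toLeft k hr.isKlingen hr.d_pos, Finsupp.smul_single,
        (hinv.comp_siegelJacobi hρ hf h1 h2).slashLeft_single hN _ _ hΩ, hmult, map_smul, hRv,
        smul_eq_mul, mul_smul]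
      rfl

theorem theorem9p4_general [Fact p.Prime] (hN : 1 ≤ N) (hρ : IsRationalRep ρ)
    (h1 : ∀ A : GeneralLinearGroup (Fin N) ℂ, R ∘ₗ ρ (diagGL 1 A) = ρ₀ A ∘ₗ R)
    (h2 : ∀ a : ℂˣ, R ∘ₗ ρ (diagGL a 1) = ((a : ℂ) ^ k) • R) {lam : ℤ} (hlam : lam ≠ 0)
    (hf : HasJacobiFourier 𝓜 lam f) (hinv : IsSlashInvariant ρ 𝓜 f) (T : HeckeModule (N + 1) p) :
    ∃ S : HeckeModule N p, IsZharkovskaya k T S ∧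
      ∀ Ω ∈ siegelH N, ∀ Z : Matrix (Fin m) (Fin N) ℂ,
        Tendsto (siegelPath f Ω Z) atTop (𝓝 (siegelJacobi f Ω Z)) ∧
        Tendsto (siegelPath (slashHecke ρ 𝓜 f T) Ω Z) atTop
          (𝓝 (siegelJacobi (slashHecke ρ 𝓜 f T) Ω Z)) ∧
        R (siegelJacobi (slashHecke ρ 𝓜 f T) Ω Z) =
          slashHecke ρ₀ 𝓜 (fun Ω' Z' => R (siegelJacobi f Ω' Z')) S Ω Z := by
  have hlim := hf.hasSiegelLimit hlam
  obtain ⟨S, hS⟩ := exists_isZharkovskaya k T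
  refine ⟨S, hS, fun Ω hΩ Z => ⟨hlim.tendsto_siegelPath hΩ Z, ?_⟩⟩
  obtain ⟨v, hv, hRv⟩ := hinv.exists_tendsto_siegelPath_slashLeft hN hρ hlim h1 h2
    (heckeToLeft (N + 1) p T) hΩ Z
  have hsiegel : siegelJacobi (slashHecke ρ 𝓜 f T) Ω Z = v := hv.limUnder_eq
  rw [hsiegel, slashHecke, slashHecke, hS]
  exact ⟨hv, hRv⟩

end Commutation

end SiegelJacobi

end

open SiegelJacobi in
/-- The degree is `n = N + 1 ≥ 2`. The element `S` is `T*`; the two `Tendsto` parts say that the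
limits which define both sides exist. -/
theorem theorem9p4 {N m p : ℕ} (hN : 1 ≤ N) (hm : 1 ≤ m) [Fact p.Prime]
    {V V₀ : Type*} [NormedAddCommGroup V] [NormedSpace ℂ V] [FiniteDimensional ℂ V]
    [NormedAddCommGroup V₀] [NormedSpace ℂ V₀] [FiniteDimensional ℂ V₀]
    (𝓜 : Matrix (Fin m) (Fin m) ℝ) (h𝓜 : 𝓜.PosSemidef) (h𝓜' : HalfIntegral 𝓜)
    (ρ : Representation ℂ (Matrix.GeneralLinearGroup (Fin (N + 1)) ℂ) V) (hρ : IsRationalRep ρ)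
    (ρ₀ : Representation ℂ (Matrix.GeneralLinearGroup (Fin N) ℂ) V₀) (hρ₀ : IsRationalRep ρ₀)
    (R : V →ₗ[ℂ] V₀) (k : ℤ)
    (h1 : ∀ A : Matrix.GeneralLinearGroup (Fin N) ℂ, R ∘ₗ ρ (diagGL 1 A) = ρ₀ A ∘ₗ R)
    (h2 : ∀ a : ℂˣ, R ∘ₗ ρ (diagGL a 1) = ((a : ℂ) ^ k) • R)
    (f : Matrix (Fin (N + 1)) (Fin (N + 1)) ℂ → Matrix (Fin m) (Fin (N + 1)) ℂ → V)
    (hf : IsJacobiForm ρ 𝓜 ⊤ f) (T : HeckeModule (N + 1) p) :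
    ∃ S : HeckeModule N p, IsZharkovskaya k T S ∧
      ∀ Ω ∈ siegelH N, ∀ Z : Matrix (Fin m) (Fin N) ℂ,
        Filter.Tendsto (siegelPath f Ω Z) Filter.atTop (nhds (siegelJacobi f Ω Z)) ∧
        Filter.Tendsto (siegelPath (slashHecke ρ 𝓜 f T) Ω Z) Filter.atTop
          (nhds (siegelJacobi (slashHecke ρ 𝓜 f T) Ω Z)) ∧
        R (siegelJacobi (slashHecke ρ 𝓜 f T) Ω Z) =
          slashHecke ρ₀ 𝓜 (fun Ω' Z' => R (siegelJacobi f Ω' Z')) S Ω Z := by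
  obtain ⟨lam, hlam, hfourier⟩ := hf.fourier
  have hf1 := hfourier 1
  rw [OneMemClass.coe_one, slash_one_one] at hf1
  exact theorem9p4_general hN hρ h1 h2 hlam hf1
    (fun γ Ω hΩ Z => hf.invariant γ trivial 0 0 0 (by simp [Matrix.IsSymm]) Ω hΩ Z) T
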